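/- \textbf{Setting.} Let $h_k\in\mathbb C^M$, $\bar\gamma_k,\sigma_k^2>0$ for $k=1,\dots,K$, and $\bar C_m,\bar P_m>0$ for $m=1,\dots,M$. For Hermitian $V_k,Q\in\mathbb C^{M\times M}$ put $\mathrm{PW}_m=\sum_k V_k^{(m,m)}+Q^{(m,m)}$, let $E_m$ be the matrix whose only nonzero entry is a $1$ at $(m,m)$, and consider the constraints, for $V_k\succeq0$, $Q\succeq 0$, $$\text{(S)}\ \ h_k^\dagger\Big((1+\bar\gamma_k^{-1})V_k-\sum_jV_j-Q\Big)h_k\ge\sigma_k^2,\qquad \text{(F)}\ \begin{bmatrix}0&0\\0&Q^{(m:M,m:M)}\end{bmatrix}-2^{-\bar C_m}\mathrm{PW}_mE_m\succeq0,\qquad \text{(P)}\ \ \mathrm{PW}_m\le\bar P_m .$$ Assume that (S), (F), (P) are strictly feasible (with $V_k,Q\succ0$, (S) and (P) strict, and (F) positive definite on the block $(m{:}M,m{:}M)$). For $x\in\mathbb R^M$ let $d(x)$ be the infimum of $\sum_m\big((1+x_m)\mathrm{PW}_m-x_m\bar P_m\big)$ over all $V_k,Q\succeq0$ satisfying (S)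 and (F). For $\beta,p\in\mathbb R^K_+$ and $x\in\mathbb R^M_+$ let $\Lambda_m=\Lambda_{x,m}(\beta)\succeq0$ be the rank-one matrices, $\Lambda_m$ vanishing in the rows and columns before $m$, with $\sum_m2^{\bar C_m}\Lambda_m=C(\beta,x)$, where $$C(\beta,x)=I+\mathrm{Diag}(x)+\sum_k\beta_kh_kh_k^\dagger+\mathrm{Diag}(\Lambda_1^{(1,1)},\dots,\Lambda_M^{(M,M)}).$$ Let $u_k=u_k(\beta,x)=C(\beta,x)^{-1}h_k/\|C(\beta,x)^{-1}h_k\|$, and let $Q_{\beta,x}(p)$ be the Hermitian matrix $Q$ with $\Lambda_m\Big(2^{\bar C_m}\begin{bmatrix}0&0\\0&Q^{(m:M,m:M)}\end{bmatrix}-\big(\sum_kp_k|u_k^{(m)}|^2+Q^{(m,m)}\big)E_m\Big)=0$ for all $m$. Define $$(I_x(\beta))_k=\frac{\bar\gamma_k}{\bar\gamma_k+1}\cdot\frac1{h_k^\dagger C(\beta,x)^{-1}h_k},\qquad (J_{\beta,x}(p))_k=\frac{\bar\gamma_k\big(\sum_{j\ne k}p_j|h_k^\dagger u_j|^2+h_k^\dagger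 Q_{\beta,x}(p)h_k+\sigma_k^2\big)}{|h_k^\dagger u_k|^2},$$ $$\tilde d(\beta,x)=\sum_k\beta_k\sigma_k^2-\sum_mx_m\bar P_m,\qquad (g(\beta,p,x))_m=\sum_kp_k|u_k^{(m)}|^2+Q_{\beta,x}(p)^{(m,m)}-\bar P_m .$$ Let $\beta^\star(x)$ be the fixed point of $I_x$ in $\mathbb R^K_+$, let $p^\star(\beta,x)$ be the fixed point of $J_{\beta,x}$ in $\mathbb R^K_+$ (if there is one), and $p^\star(x)=p^\star(\beta^\star(x),x)$. Thompson's metric on $\mathbb R^K_{++}$ is $\mu(p,q)=\max_k|\log p_k-\log q_k|$, and $\|\cdot\|$ is the Euclidean norm. \textbf{Procedure.} Let $x\ge0$, $\mathrm{res}_1,\mathrm{res}_2\ge0$ and $\mathrm{res}=\mathrm{res}_1+\mathrm{res}_2$. From $\beta^{(0)}\in\mathbb R^K_+$ iterate $\beta^{(i+1)}=I_x(\beta^{(i)})$, stop when $\mu(\beta^{(i)},\beta^{(i+1)})\le\mathrm{res}_1$, and put $\tilde\beta=\beta^{(i+1)}$; then from $p^{(0)}\in\mathbb R^K_+$ iterate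 $p^{(j+1)}=J_{\tilde\beta,x}(p^{(j)})$, stop when $\mu(p^{(j)},p^{(j+1)})\le\mathrm{res}_2$, and put $\tilde p=p^{(j+1)}$. (A test fails while $\beta^{(i)}$ or $p^{(j)}$ has a zero entry.) \textbf{Assumption 3} (with constants $\kappa_1>0$, $L_1,L_2\ge0$). (a) $J_{\tilde\beta,x}$ has a fixed point in $\mathbb R_+^K$. (b) $\mu(J_{\tilde\beta,x}(\tilde p),J_{\tilde\beta,x}(p^\star(x)))\le\kappa_1\,\mu(\tilde p,p^\star(x))$. (c) $\|p^\star(\tilde\beta,x)-p^\star(x)\|\le L_1\|\tilde\beta-\beta^\star(x)\|$ and $\|g(\tilde\beta,\tilde p,x)-g(\beta^\star(x),p^\star(x),x)\|\le L_2\big(\|\tilde\beta-\beta^\star(x)\|+\|\tilde p-p^\star(x)\|\big)$. \textbf{Proposition 4.} Let $x\ge0$. Then $d$ is differentiable at $x$, and for all $B$, $\kappa_1>0$, $L_1,L_2\ge0$ there is a constant $C(x)\ge0$, depending only on the problem data, $x$, $B$, $\kappa_1$, $L_1$, $L_2$, such that for all $\mathrm{res}_1,\mathrm{res}_2\ge0$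 and every output $(\tilde\beta,\tilde p)$ of the procedure (for any starting points) that satisfies Assumption 3 with the constants $\kappa_1,L_1,L_2$ and $\|\tilde\beta\|,\|\tilde p\|\le B$, $$|\tilde d(\tilde\beta,x)-d(x)|\le C(x)\,\mathrm{res},\qquad \|g(\tilde\beta,\tilde p,x)-\nabla d(x)\|\le C(x)\,\mathrm{res}.$$ (In particular every single output satisfying Assumption 3 obeys these bounds, with $B=\max\{\|\tilde\beta\|,\|\tilde p\|\}$.) -/

import Mathlib

open scoped Matrix ComplexOrder BigOperators

noncomputable section

/-- Data of a cooperative cellular network with `M` single-antenna base stations and `K`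
single-antenna users: channel vectors `h k`, SINR targets `γ k`, fronthaul capacities `cap m`,
per-antenna power budgets `P m` and noise powers `σsq k` (written `σ_k²` in the literature). -/
structure Network (M K : ℕ) where
  h : Fin K → Fin M → ℂ
  γ : Fin K → ℝ
  cap : Fin M → ℝ
  P : Fin M → ℝ
  σsq : Fin K → ℝ
  γ_pos : ∀ k, 0 < γ k
  cap_pos : ∀ m, 0 < cap m
  P_pos : ∀ m, 0 < P m
  σsq_pos : ∀ k, 0 < σsq k

/-- Thompson's metric on vectors with positive entries. -/
def thompson {K : ℕ} (p q : EuclideanSpace ℝ (Fin K)) : ℝ :=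
  ⨆ k, |Real.log (p k) - Real.log (q k)|

namespace Network

variable {M K : ℕ} (N : Network M K)

/-! ### The semidefinite program and its partial Lagrangian dual function -/

/-- Transmit power of antenna `m`. -/
def power (V : Fin K → Matrix (Fin M) (Fin M) ℂ) (Q : Matrix (Fin M) (Fin M) ℂ) (m : Fin M) : ℝ :=
  (∑ k, (V k m m).re) + (Q m m).re

/-- Left-hand side of the `k`-th SINR constraint: the inner product of
`(1 + 1/γ_k) V_k - ∑_j V_j - Q` with `h_k h_k†`. -/
def sinrLHS (V : Fin K → Matrix (Fin M) (Fin M) ℂ) (Q : Matrix (Fin M) (Fin M) ℂ) (k : Fin K) : ℝ :=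
  (star (N.h k) ⬝ᵥ (((1 + (N.γ k)⁻¹ : ℝ) : ℂ) • V k - (∑ j, V j) - Q) *ᵥ N.h k).re

/-- Left-hand side of the `m`-th fronthaul constraint: `Q` with the rows and columns before `m`
replaced by zero, minus `2^(-cap_m) * power_m * E_m`. -/
def fronthaulLHS (V : Fin K → Matrix (Fin M) (Fin M) ℂ) (Q : Matrix (Fin M) (Fin M) ℂ)
    (m : Fin M) : Matrix (Fin M) (Fin M) ℂ :=
  (Matrix.of fun i j => if m ≤ i ∧ m ≤ j then Q i j else 0)
    - Matrix.single m m ((power V Q m / (2 : ℝ) ^ N.cap m : ℝ) : ℂ)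

/-- Strict feasibility of the semidefinite program: all matrix variables are positive definite and
all constraints hold strictly. The `m`-th fronthaul constraint only involves the rows and columns
from `m` on, so strictness means positive definiteness of that block. -/
def StrictlyFeasible : Prop :=
  ∃ (V : Fin K → Matrix (Fin M) (Fin M) ℂ) (Q : Matrix (Fin M) (Fin M) ℂ),
    (∀ k, (V k).PosDef) ∧ Q.PosDef ∧
    (∀ k, N.σsq k < N.sinrLHS V Q k) ∧
    (∀ m, ((N.fronthaulLHS V Q m).submatrix
      (Subtype.val : {i : Fin M // m ≤ i} → Fin M) Subtype.val).PosDef) ∧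
    (∀ m, power V Q m < N.P m)

/-- Feasible set of the subproblem in which the per-antenna power constraints are dualized. -/
def SubFeasible (V : Fin K → Matrix (Fin M) (Fin M) ℂ) (Q : Matrix (Fin M) (Fin M) ℂ) : Prop :=
  (∀ k, (V k).PosSemidef) ∧ Q.PosSemidef ∧
    (∀ k, N.σsq k ≤ N.sinrLHS V Q k) ∧ (∀ m, (N.fronthaulLHS V Q m).PosSemidef)

/-- The dual function: optimal value of the subproblem with multipliers `x` for the power
constraints. -/
def dualFun (x : EuclideanSpace ℝ (Fin M)) : ℝ :=
  sInf {v : ℝ | ∃ (V : Fin K → Matrix (Fin M) (Fin M) ℂ) (Q : Matrix (Fin M) (Fin M) ℂ),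
    N.SubFeasible V Q ∧ v = ∑ m, ((1 + x m) * power V Q m - x m * N.P m)}

/-! ### The fixed-point mappings -/

/-- `I + Diag(x) + ∑_k β_k h_k h_k†`. -/
def baseMat (x : EuclideanSpace ℝ (Fin M)) (β : EuclideanSpace ℝ (Fin K)) :
    Matrix (Fin M) (Fin M) ℂ :=
  1 + Matrix.diagonal (fun m => ((x m : ℝ) : ℂ))
    + ∑ k, ((β k : ℝ) : ℂ) • Matrix.vecMulVec (N.h k) (star (N.h k))

/-- One elimination step at the index `m`. Given the remainder `S`, put
`T = S + S_mm / (2^cap_m - 1) E_m`; the result is the rank-one matrix `Λ` for which `2^cap_m Λ` has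
the same `m`-th row and column as `T`. In particular `Λ_mm = S_mm / (2^cap_m - 1)`, so `2^cap_m Λ`
and `S + Λ_mm E_m` agree in their `m`-th rows and columns. -/
def elim (m : Fin M) (S : Matrix (Fin M) (Fin M) ℂ) : Matrix (Fin M) (Fin M) ℂ :=
  let T := S + Matrix.single m m (S m m / (((2 : ℝ) ^ N.cap m - 1 : ℝ) : ℂ))
  ((((2 : ℝ) ^ N.cap m : ℝ) : ℂ) * T m m)⁻¹ • Matrix.vecMulVec (fun i => T i m) (fun j => T m j)

/-- Remainder `I + Diag(x) + ∑_k β_k h_k h_k† + ∑_{m < n} ((Λ_m)_mm E_m - 2^cap_m Λ_m)` after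
the first `n` elimination steps. -/
def remainder (x : EuclideanSpace ℝ (Fin M)) (β : EuclideanSpace ℝ (Fin K)) :
    ℕ → Matrix (Fin M) (Fin M) ℂ
  | 0 => N.baseMat x β
  | n + 1 =>
    if hn : n < M then
      remainder x β n
        + Matrix.single ⟨n, hn⟩ ⟨n, hn⟩ (N.elim ⟨n, hn⟩ (remainder x β n) ⟨n, hn⟩ ⟨n, hn⟩)
        - (((2 : ℝ) ^ N.cap ⟨n, hn⟩ : ℝ) : ℂ) • N.elim ⟨n, hn⟩ (remainder x β n)
    else remainder x β n

/-- The multiplier matrices `Λ_{x,m}(β)` of the fronthaul constraints. They are the positive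
semidefinite matrices of rank one, `Λ_m` vanishing in the rows and columns before `m`, with
`∑_m 2^cap_m Λ_m = I + Diag(x) + ∑_k β_k h_k h_k† + Diag((Λ_1)_11, …, (Λ_M)_MM)`,
obtained by eliminating the rows and columns one after the other. -/
def Lam (x : EuclideanSpace ℝ (Fin M)) (β : EuclideanSpace ℝ (Fin K)) (m : Fin M) :
    Matrix (Fin M) (Fin M) ℂ :=
  N.elim m (N.remainder x β m)

/-- The matrix `C(β, {Λ_{x,m}(β)}, x)`. -/
def Cmat (x : EuclideanSpace ℝ (Fin M)) (β : EuclideanSpace ℝ (Fin K)) :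
    Matrix (Fin M) (Fin M) ℂ :=
  N.baseMat x β + Matrix.diagonal (fun m => N.Lam x β m m m)

/-- The mapping `I_x`. -/
def Imap (x : EuclideanSpace ℝ (Fin M)) (β : EuclideanSpace ℝ (Fin K)) :
    EuclideanSpace ℝ (Fin K) :=
  WithLp.toLp 2 fun k =>
    N.γ k / (N.γ k + 1) * (1 / (star (N.h k) ⬝ᵥ (N.Cmat x β)⁻¹ *ᵥ N.h k).re)

/-- The unit-norm beamforming directions `u_k(β, x)`. -/
def beam (β : EuclideanSpace ℝ (Fin K)) (x : EuclideanSpace ℝ (Fin M)) (k : Fin K) : Fin M → ℂ :=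
  ((‖WithLp.toLp 2 ((N.Cmat x β)⁻¹ *ᵥ N.h k)‖⁻¹ : ℝ) : ℂ) • ((N.Cmat x β)⁻¹ *ᵥ N.h k)

/-- Beamforming part `∑_k p_k |u_k(β, x)^(m)|²` of the transmit power of antenna `m`. -/
def beamPower (β p : EuclideanSpace ℝ (Fin K)) (x : EuclideanSpace ℝ (Fin M)) (m : Fin M) : ℝ :=
  ∑ k, p k * ‖N.beam β x k m‖ ^ 2

/-- The entries after `m` of the `m`-th column of `Λ_{x,m}(β)`, divided by its `m`-th entry. -/
def tailVec (β : EuclideanSpace ℝ (Fin K)) (x : EuclideanSpace ℝ (Fin M)) (m : Fin M) :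
    Fin M → ℂ :=
  fun i => if m < i then N.Lam x β m i m / N.Lam x β m m m else 0

/-- One back-substitution step. Given the block `R` of `Q` on the indices after `m` (zero
elsewhere) and `t = tailVec m`, it returns the block of `Q` on the indices from `m` on:
`Q^(>m,m) = -R t` and `Q^(m,m) = t†Rt + (s + t†Rt) / (2^cap_m - 1)` with `s` the beamforming power
of antenna `m`. -/
def backStep (β p : EuclideanSpace ℝ (Fin K)) (x : EuclideanSpace ℝ (Fin M)) (m : Fin M)
    (R : Matrix (Fin M) (Fin M) ℂ) : Matrix (Fin M) (Fin M) ℂ :=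
  let t := N.tailVec β x m
  let E := 1 - Matrix.vecMulVec t (Pi.single m 1)
  Eᴴ * R * E + Matrix.single m m
    (((N.beamPower β p x m : ℝ) + star t ⬝ᵥ R *ᵥ t) / (((2 : ℝ) ^ N.cap m - 1 : ℝ) : ℂ))

/-- The compression covariance `Q_{β,x}(p)`: the Hermitian solution `Q` of the complementary
slackness equations
`Λ_{x,m}(β) * (2^cap_m [0, 0; 0, Q^(m:M,m:M)] - (∑_k p_k |u_k^(m)|² + Q^(m,m)) E_m) = 0`
for all `m`, computed by back substitution from the last index to the first. -/
def Qmat (β p : EuclideanSpace ℝ (Fin K)) (x : EuclideanSpace ℝ (Fin M)) :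
    Matrix (Fin M) (Fin M) ℂ :=
  (List.finRange M).foldr (fun m R => N.backStep β p x m R) 0

/-- The mapping `J_{β,x}`. -/
def Jmap (β : EuclideanSpace ℝ (Fin K)) (x : EuclideanSpace ℝ (Fin M))
    (p : EuclideanSpace ℝ (Fin K)) : EuclideanSpace ℝ (Fin K) :=
  WithLp.toLp 2 fun k =>
    N.γ k * ((∑ j ∈ Finset.univ.erase k, p j * ‖star (N.h k) ⬝ᵥ N.beam β x j‖ ^ 2)
        + (star (N.h k) ⬝ᵥ N.Qmat β p x *ᵥ N.h k).re + N.σsq k)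
      / ‖star (N.h k) ⬝ᵥ N.beam β x k‖ ^ 2

/-- The fixed point `β⋆(x)` of `I_x` in the nonnegative orthant. -/
def betaStar (x : EuclideanSpace ℝ (Fin M)) : EuclideanSpace ℝ (Fin K) :=
  Classical.epsilon fun β => (∀ k, 0 ≤ β k) ∧ N.Imap x β = β

/-- The fixed point `p⋆(β, x)` of `J_{β,x}` in the nonnegative orthant. -/
def pStar (β : EuclideanSpace ℝ (Fin K)) (x : EuclideanSpace ℝ (Fin M)) :
    EuclideanSpace ℝ (Fin K) :=
  Classical.epsilon fun p => (∀ k, 0 ≤ p k) ∧ N.Jmap β x p = p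

/-! ### Approximate values and the two-stage procedure -/

/-- The approximate dual value `∑_k β_k σ_k² - ∑_m x_m P_m`. -/
def dTilde (β : EuclideanSpace ℝ (Fin K)) (x : EuclideanSpace ℝ (Fin M)) : ℝ :=
  (∑ k, β k * N.σsq k) - ∑ m, x m * N.P m

/-- The approximate gradient `g(β, p, x)`. -/
def gradApprox (β p : EuclideanSpace ℝ (Fin K)) (x : EuclideanSpace ℝ (Fin M)) :
    EuclideanSpace ℝ (Fin M) :=
  WithLp.toLp 2 fun m => N.beamPower β p x m + (N.Qmat β p x m m).re - N.P m

end Network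

/-- `z` is the output `z^(i+1)` of the iteration `z^(i+1) = F(z^(i))` from `z₀`, stopped at an index
`i` at which the residual test `μ(z^(i), z^(i+1)) ≤ res` succeeds. Thompson's metric is only defined
for positive vectors, so the test fails when `z^(i)` has a zero entry, as `z₀` may have. Stopping at
the first successful test is a special case. -/
def IsStageOutput {K : ℕ} (F : EuclideanSpace ℝ (Fin K) → EuclideanSpace ℝ (Fin K)) (res : ℝ)
    (z₀ z : EuclideanSpace ℝ (Fin K)) : Prop :=
  ∃ i : ℕ, (∀ k, 0 < (F^[i] z₀) k) ∧ (∀ k, 0 < (F^[i + 1] z₀) k) ∧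
    thompson (F^[i] z₀) (F^[i + 1] z₀) ≤ res ∧ z = F^[i + 1] z₀

namespace Network

variable {M K : ℕ} (N : Network M K)

/-- `(βt, pt)` is an output of the two-stage procedure at `x` with tolerances `res₁`, `res₂`, for
some nonnegative starting points. -/
def IsOutput (x : EuclideanSpace ℝ (Fin M)) (res₁ res₂ : ℝ) (βt pt : EuclideanSpace ℝ (Fin K)) :
    Prop :=
  ∃ β₀ p₀ : EuclideanSpace ℝ (Fin K), (∀ k, 0 ≤ β₀ k) ∧ (∀ k, 0 ≤ p₀ k) ∧
    IsStageOutput (N.Imap x) res₁ β₀ βt ∧ IsStageOutput (N.Jmap βt x) res₂ p₀ pt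

/-- The regularity assumption on the output `(βt, pt)` at `x`, with constants `κ₁`, `L₁`, `L₂`. -/
structure Regular (x : EuclideanSpace ℝ (Fin M)) (βt pt : EuclideanSpace ℝ (Fin K))
    (κ₁ L₁ L₂ : ℝ) : Prop where
  exists_fixedPoint : ∃ p : EuclideanSpace ℝ (Fin K), (∀ k, 0 ≤ p k) ∧ N.Jmap βt x p = p
  contraction : thompson (N.Jmap βt x pt) (N.Jmap βt x (N.pStar (N.betaStar x) x))
    ≤ κ₁ * thompson pt (N.pStar (N.betaStar x) x)
  lipschitz_pStar : ‖N.pStar βt x - N.pStar (N.betaStar x) x‖ ≤ L₁ * ‖βt - N.betaStar x‖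
  lipschitz_grad : ‖N.gradApprox βt pt x
      - N.gradApprox (N.betaStar x) (N.pStar (N.betaStar x) x) x‖
    ≤ L₂ * (‖βt - N.betaStar x‖ + ‖pt - N.pStar (N.betaStar x) x‖)

end Network

end

/-! Weak duality: every β ≥ 0 with β ≤ I_x(β) bounds the dual function from below by Σ β_k σ_k² − Σ
x_m P_m (`weak_duality`), because C(β,x) dominates β_k (1 + 1/γ_k) h_k h_k† and is also a sum of
rank-one matrices that pair with the fronthaul constraints. At the fixed point β⋆ of I_x, the
directions u_k, the powers p with p = J(p) and the back-substituted Q are feasible and satisfy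
complementary slackness, so the bound is attained (`cost_star`, `dualFun_eq`). Strict feasibility
enters only through h_k ≠ 0 and the existence of one feasible point.

Both I_x and J satisfy F(p) ≤ α F(q) − (α − 1) c whenever p ≤ α q and α ≥ 1. For I_x the reason is
concavity: an elimination step is a Schur complement, hence a partial minimum of a Hermitian form,
and 1/(h†C⁻¹h) is a minimum as well. For J the right-hand side is noise plus interference that
scales with p. This inequality yields fixed points once subsolutions are bounded
(`exists_fixedPoint`) and a linear error estimate: at the coordinate where p and the fixed point
differ most in ratio, the gain (α − 1) c has to be paid for by the residual factor e^r − 1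
(`abs_sub_fixedPoint_le`). Applied to a perturbed mapping, the same estimate makes the fixed points
continuous in x.

The feasible set of the subproblem does not involve x and its cost is affine in x, so g(β⋆,p⋆,x) is
a supergradient; being continuous at x, it is the gradient (`hasGradientAt_dualFun`). The error
bounds follow: `dTilde` is affine in β, and the gradient error is controlled by the regularity
assumption once β̃ is compared with β⋆(x), p̃ with p⋆(β̃,x), and the latter with p⋆(x). -/

noncomputable section

/-! ### Standard interference mappings -/

/-- A quantitative form of the axioms of standard interference functions (monotonicity and
scalability), as satisfied by every concave mapping of the nonnegative orthant into itself whose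
values have all entries at least `c`. -/
def IsInterference {K : ℕ} (F : EuclideanSpace ℝ (Fin K) → EuclideanSpace ℝ (Fin K)) (c : ℝ) :
    Prop :=
  ∀ (p q : EuclideanSpace ℝ (Fin K)) (α : ℝ), (∀ k, 0 ≤ p k) → (∀ k, 0 ≤ q k) → 1 ≤ α →
    (∀ k, p k ≤ α * q k) → ∀ k, F p k ≤ α * F q k - (α - 1) * c

namespace IsInterference

variable {K : ℕ} {F : EuclideanSpace ℝ (Fin K) → EuclideanSpace ℝ (Fin K)} {c : ℝ}
  {p q : EuclideanSpace ℝ (Fin K)}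

theorem mono (hF : IsInterference F c) (hp : ∀ k, 0 ≤ p k) (hpq : ∀ k, p k ≤ q k) (k : Fin K) :
    F p k ≤ F q k := by
  have := hF p q 1 hp (fun k => (hp k).trans (hpq k)) le_rfl (by simpa using hpq) k
  linarith

/-- Comparing p with itself at α = 2 leaves exactly c. -/
theorem le_apply (hF : IsInterference F c) (hp : ∀ k, 0 ≤ p k) (k : Fin K) : c ≤ F p k := by
  have := hF p p 2 hp hp one_le_two (fun k => by linarith [hp k]) k
  linarith

theorem scale_le (hF : IsInterference F c) (hc : 0 ≤ c) (hp : ∀ k, 0 ≤ p k) (hq : ∀ k, 0 ≤ q k)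
    {α : ℝ} (hα : 1 ≤ α) (hpq : ∀ k, p k ≤ α * q k) (k : Fin K) : F p k ≤ α * F q k := by
  have := hF p q α hp hq hα hpq k
  nlinarith [mul_nonneg (sub_nonneg.2 hα) hc]

/-- Knaster–Tarski: a standard mapping with bounded subsolutions has a fixed point. -/
theorem exists_fixedPoint (hF : IsInterference F c) (hc : 0 ≤ c) {R : ℝ}
    (hR : ∀ p : EuclideanSpace ℝ (Fin K), (∀ k, 0 ≤ p k) → (∀ k, p k ≤ F p k) → ∀ k, p k ≤ R) :
    ∃ q : EuclideanSpace ℝ (Fin K), (∀ k, 0 ≤ q k) ∧ F q = q := by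
  let S : Set (EuclideanSpace ℝ (Fin K)) := {p | (∀ k, 0 ≤ p k) ∧ ∀ k, p k ≤ F p k}
  have h0 : (0 : EuclideanSpace ℝ (Fin K)) ∈ S :=
    ⟨fun k => le_rfl, fun k => hc.trans (hF.le_apply (fun k => le_rfl) k)⟩
  have hbdd : ∀ k, BddAbove ((fun p : EuclideanSpace ℝ (Fin K) => p k) '' S) := by
    rintro k
    refine ⟨R, ?_⟩
    rintro _ ⟨p, hp, rfl⟩
    exact hR p hp.1 hp.2 k
  -- The candidate is the entrywise supremum of all nonnegative subsolutions.
  let q : EuclideanSpace ℝ (Fin K) :=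
    WithLp.toLp 2 fun k => sSup ((fun p : EuclideanSpace ℝ (Fin K) => p k) '' S)
  have hle : ∀ p ∈ S, ∀ k, p k ≤ q k := fun p hp k => le_csSup (hbdd k) ⟨p, hp, rfl⟩
  have hq0 : ∀ k, 0 ≤ q k := hle 0 h0
  have hqF : ∀ k, q k ≤ F q k := by
    intro k
    refine csSup_le ⟨_, 0, h0, rfl⟩ ?_
    rintro _ ⟨p, hp, rfl⟩
    exact (hp.2 k).trans (hF.mono hp.1 (hle p hp) k)
  -- The image of the largest subsolution is again a subsolution, hence lies below it.
  have hFS : F q ∈ S :=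
    ⟨fun k => hc.trans (hF.le_apply hq0 k), fun k => hF.mono hq0 hqF k⟩
  refine ⟨q, hq0, ?_⟩
  ext k
  exact le_antisymm (hle _ hFS k) (hqF k)

/-- Approximate fixed points in Thompson's metric are close to the fixed point, with constants that
only depend on bounds for the entries. -/
theorem abs_sub_fixedPoint_le (hF : IsInterference F c) (hc : 0 < c) {R r : ℝ}
    (hq0 : ∀ k, 0 ≤ q k) (hq : F q = q) (hqR : ∀ k, q k ≤ R)
    (hpc : ∀ k, c ≤ p k) (hpR : ∀ k, p k ≤ R) (hr : 0 ≤ r)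
    (h1 : ∀ k, p k ≤ Real.exp r * F p k) (h2 : ∀ k, F p k ≤ Real.exp r * p k) (k : Fin K) :
    |p k - q k| ≤ 2 * R ^ 3 / c ^ 2 * r := by
  have hqc : ∀ k, c ≤ q k := fun k => by
    have := hF.le_apply hq0 k
    rwa [hq] at this
  have hp0 : ∀ k, 0 < p k := fun k => hc.trans_le (hpc k)
  have hq0' : ∀ k, 0 < q k := fun k => hc.trans_le (hqc k)
  have hcR : c ≤ R := (hpc k).trans (hpR k)
  have hR : 0 < R := hc.trans_le hcR
  have hRc : R ≤ 2 * R ^ 3 / c ^ 2 := by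
    rw [le_div_iff₀ (by positivity)]
    have : c ^ 2 ≤ R ^ 2 := by gcongr
    nlinarith [mul_le_mul_of_nonneg_left this hR.le, pow_pos hR 3]
  -- For r ≥ 1 the trivial bound R suffices, by `hRc`; for r ≤ 1 the exponential is linearized by
  -- e^r − 1 ≤ 2r.
  rcases le_total 1 r with hr1 | hr1
  · calc |p k - q k| ≤ R := by
          rw [abs_le]; constructor <;> linarith [hpR k, hqR k, hp0 k, hq0' k]
      _ ≤ 2 * R ^ 3 / c ^ 2 * 1 := by simpa using hRc
      _ ≤ 2 * R ^ 3 / c ^ 2 * r := by gcongr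
  have hexp : Real.exp r - 1 ≤ 2 * r := by
    have h := Real.abs_exp_sub_one_le (x := r) (by rwa [abs_of_nonneg hr])
    rw [abs_of_nonneg hr] at h
    exact (le_abs_self _).trans h
  have hexp1 : 1 ≤ Real.exp r := Real.one_le_exp hr
  have : Nonempty (Fin K) := ⟨k⟩
  -- The number α below is the exponential of the Thompson distance of p and q, attained at the
  -- index l.
  obtain ⟨l, hl⟩ := Finite.exists_max fun k => max (p k / q k) (q k / p k)
  obtain ⟨α, hα⟩ : ∃ α, α = max (p l / q l) (q l / p l) := ⟨_, rfl⟩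
  have hpq : ∀ k, p k ≤ α * q k := fun k => by
    rw [← div_le_iff₀ (hq0' k), hα]; exact (le_max_left _ _).trans (hl k)
  have hqp : ∀ k, q k ≤ α * p k := fun k => by
    rw [← div_le_iff₀ (hp0 k), hα]; exact (le_max_right _ _).trans (hl k)
  have hα1 : 1 ≤ α := by
    by_contra! h
    nlinarith [hpq l, hqp l, hp0 l, hq0' l]
  have hαR : α ≤ R / c := by
    rw [hα]
    refine max_le ?_ ?_
    · exact div_le_div₀ hR.le (hpR l) hc (hqc l)
    · exact div_le_div₀ hR.le (hqR l) hc (hpc l)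
  -- If p_l = α q_l, then p_l ≤ e^r F(p)_l ≤ e^r (α q_l − (α − 1) c). If q_l = α p_l, then q_l =
  -- F(q)_l ≤ α e^r p_l − (α − 1) c.
  have key : (α - 1) * c ≤ α * R * (Real.exp r - 1) := by
    have hα0 : 0 ≤ α := zero_le_one.trans hα1
    have he : 0 ≤ Real.exp r - 1 := sub_nonneg.2 hexp1
    rcases max_choice (p l / q l) (q l / p l) with h | h
    · rw [h, eq_div_iff (hq0' l).ne'] at hα
      have h3 := hF p q α (fun k => (hp0 k).le) hq0 hα1 hpq l
      rw [hq] at h3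
      have h4 := mul_le_mul_of_nonneg_left h3 (Real.exp_pos r).le
      have h5 : (α - 1) * c ≤ Real.exp r * ((α - 1) * c) :=
        le_mul_of_one_le_left (mul_nonneg (by linarith) hc.le) hexp1
      have h6 : α * q l * (Real.exp r - 1) ≤ α * R * (Real.exp r - 1) := by
        gcongr; exact hqR l
      nlinarith [h1 l]
    · rw [h, eq_div_iff (hp0 l).ne'] at hα
      have h3 := hF q p α hq0 (fun k => (hp0 k).le) hα1 hqp l
      rw [hq] at h3
      have h4 := mul_le_mul_of_nonneg_left (h2 l) hα0
      have h6 : α * p l * (Real.exp r - 1) ≤ α * R * (Real.exp r - 1) := by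
        gcongr; exact hpR l
      nlinarith
  have hα2 : α - 1 ≤ 2 * R ^ 2 / c ^ 2 * r := by
    have h3 : (α - 1) * c ≤ R / c * R * (2 * r) :=
      key.trans (by gcongr)
    have h4 : 2 * R ^ 2 / c ^ 2 * r = R / c * R * (2 * r) / c := by
      field_simp
    rw [h4, le_div_iff₀ hc]
    exact h3
  calc |p k - q k| ≤ (α - 1) * R := by
        rw [abs_le]
        constructor <;>
          nlinarith [hpq k, hqp k, hpR k, hqR k,
            mul_le_mul_of_nonneg_left (hpR k) (sub_nonneg.2 hα1),
            mul_le_mul_of_nonneg_left (hqR k) (sub_nonneg.2 hα1)]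
    _ ≤ 2 * R ^ 2 / c ^ 2 * r * R := by gcongr
    _ = 2 * R ^ 3 / c ^ 2 * r := by ring

end IsInterference

/-! ### Thompson's metric, stage outputs and norm comparisons -/

theorem le_exp_mul_of_thompson_le {K : ℕ} {p q : EuclideanSpace ℝ (Fin K)} (hp : ∀ k, 0 < p k)
    (hq : ∀ k, 0 < q k) {r : ℝ} (h : thompson p q ≤ r) (k : Fin K) :
    p k ≤ Real.exp r * q k ∧ q k ≤ Real.exp r * p k := by
  have h1 : |Real.log (p k) - Real.log (q k)| ≤ r :=
    (le_ciSup (f := fun k => |Real.log (p k) - Real.log (q k)|)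
      (Set.finite_range _).bddAbove k).trans h
  rw [abs_le] at h1
  constructor
  · rw [← Real.log_le_log_iff (hp k) (by have := hq k; positivity),
      Real.log_mul (Real.exp_pos r).ne' (hq k).ne', Real.log_exp]
    linarith
  · rw [← Real.log_le_log_iff (hq k) (by have := hp k; positivity),
      Real.log_mul (Real.exp_pos r).ne' (hp k).ne', Real.log_exp]
    linarith

/-- The output of a stage is an approximate fixed point. -/
theorem IsStageOutput.approx {K : ℕ} {F : EuclideanSpace ℝ (Fin K) → EuclideanSpace ℝ (Fin K)}
    {c res : ℝ} {z₀ z : EuclideanSpace ℝ (Fin K)} (hF : IsInterference F c) (hc : 0 ≤ c)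
    (hres : 0 ≤ res) (h : IsStageOutput F res z₀ z) :
    (∀ k, c ≤ z k) ∧ (∀ k, z k ≤ Real.exp res * F z k) ∧ ∀ k, F z k ≤ Real.exp res * z k := by
  obtain ⟨i, h0, h1, hth, rfl⟩ := h
  have key := le_exp_mul_of_thompson_le h0 h1 hth
  have hexp1 : 1 ≤ Real.exp res := Real.one_le_exp hres
  rw [Function.iterate_succ_apply'] at *
  -- The output is z = F(y) with y the last tested iterate. This gives z ≥ c, and applying F to y ≤
  -- e^r z and z ≤ e^r y moves the residual bound from y to z.
  refine ⟨hF.le_apply fun k => (h0 k).le, ?_, ?_⟩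
  · exact hF.scale_le hc (fun k => (h0 k).le) (fun k => (h1 k).le) hexp1 fun k => (key k).1
  · exact hF.scale_le hc (fun k => (h1 k).le) (fun k => (h0 k).le) hexp1 fun k => (key k).2

theorem exists_pos_forall_le {K : ℕ} {f : Fin K → ℝ} (hf : ∀ k, 0 < f k) :
    ∃ c, 0 < c ∧ ∀ k, c ≤ f k := by
  rcases isEmpty_or_nonempty (Fin K) with h | h
  · exact ⟨1, one_pos, fun k => h.elim k⟩
  · obtain ⟨l, hl⟩ := Finite.exists_min f
    exact ⟨f l, hf l, hl⟩

theorem EuclideanSpace.abs_apply_le_norm {K : ℕ} (z : EuclideanSpace ℝ (Fin K)) (k : Fin K) :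
    |z k| ≤ ‖z‖ := by
  simpa using PiLp.norm_apply_le z k

theorem EuclideanSpace.norm_le_sum_abs {K : ℕ} (z : EuclideanSpace ℝ (Fin K)) :
    ‖z‖ ≤ ∑ k, |z k| := by
  rw [EuclideanSpace.norm_eq]
  refine Real.sqrt_le_iff.2 ⟨Finset.sum_nonneg fun k _ => abs_nonneg _, ?_⟩
  simp only [Real.norm_eq_abs]
  exact Finset.sum_sq_le_sq_sum_of_nonneg fun k _ => abs_nonneg _

namespace Matrix

/-! ### Real quadratic forms and trace inner products of complex matrices -/

variable {n : Type*} [Fintype n]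

/-- The real part `Re (w† A w)` of the quadratic form of a complex matrix. -/
def quad (A : Matrix n n ℂ) (w : n → ℂ) : ℝ := (star w ⬝ᵥ A *ᵥ w).re

/-- The real trace inner product `Re tr (A V)`. -/
def traceInner (A V : Matrix n n ℂ) : ℝ := (A * V).trace.re

theorem quad_zero (w : n → ℂ) : quad 0 w = 0 := by simp [quad]

theorem quad_neg_right (A : Matrix n n ℂ) (w : n → ℂ) : quad A (-w) = quad A w := by
  simp [quad, mulVec_neg]

theorem quad_add (A B : Matrix n n ℂ) (w : n → ℂ) : quad (A + B) w = quad A w + quad B w := by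
  simp [quad, add_mulVec]

theorem quad_sub (A B : Matrix n n ℂ) (w : n → ℂ) : quad (A - B) w = quad A w - quad B w := by
  simp [quad, sub_mulVec]

theorem quad_smul (r : ℝ) (A : Matrix n n ℂ) (w : n → ℂ) :
    quad ((r : ℂ) • A) w = r * quad A w := by
  simp [quad, smul_mulVec]

theorem quad_sum {ι : Type*} (s : Finset ι) (A : ι → Matrix n n ℂ) (w : n → ℂ) :
    quad (∑ i ∈ s, A i) w = ∑ i ∈ s, quad (A i) w := by
  induction s using Finset.cons_induction with
  | empty => simp [quad_zero]
  | cons a s ha ih => simp [Finset.sum_cons, quad_add, ih]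

theorem quad_vecMulVec (v w : n → ℂ) : quad (vecMulVec v (star v)) w = ‖star v ⬝ᵥ w‖ ^ 2 := by
  have h : star w ⬝ᵥ v = star (star v ⬝ᵥ w) := star_dotProduct w v
  rw [quad, vecMulVec_mulVec, dotProduct_comm, ← Complex.normSq_eq_norm_sq,
    ← Complex.ofReal_re (Complex.normSq _), Complex.normSq_eq_conj_mul_self]
  simp [smul_dotProduct, dotProduct_comm v, h]

theorem quad_conjTranspose_mul_mul (E R : Matrix n n ℂ) (w : n → ℂ) :
    quad (Eᴴ * R * E) w = quad R (E *ᵥ w) := by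
  simp only [quad, ← mulVec_mulVec, dotProduct_mulVec, star_mulVec]

theorem norm_star_dotProduct_comm (v w : n → ℂ) : ‖star v ⬝ᵥ w‖ = ‖star w ⬝ᵥ v‖ := by
  rw [star_dotProduct, norm_star]

theorem IsHermitian.star_dotProduct_mulVec {A : Matrix n n ℂ} (hA : A.IsHermitian) (v w : n → ℂ) :
    star (star v ⬝ᵥ A *ᵥ w) = star w ⬝ᵥ A *ᵥ v := by
  rw [← star_dotProduct, star_mulVec, hA.eq, dotProduct_mulVec]

theorem IsHermitian.ofReal_quad {A : Matrix n n ℂ} (hA : A.IsHermitian) (w : n → ℂ) :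
    (quad A w : ℂ) = star w ⬝ᵥ A *ᵥ w :=
  Complex.conj_eq_iff_re.1 (hA.star_dotProduct_mulVec w w)

theorem IsHermitian.posSemidef_of_quad {A : Matrix n n ℂ} (hA : A.IsHermitian)
    (h : ∀ w, 0 ≤ quad A w) : A.PosSemidef :=
  .of_dotProduct_mulVec_nonneg hA fun w => by
    rw [← hA.ofReal_quad]; exact_mod_cast h w

theorem PosSemidef.quad_nonneg {A : Matrix n n ℂ} (hA : A.PosSemidef) (w : n → ℂ) :
    0 ≤ quad A w :=
  (Complex.le_def.1 (hA.dotProduct_mulVec_nonneg w)).1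

/-- Completing the square in a Hermitian form along the direction `v`. -/
theorem IsHermitian.quad_add_smul {A : Matrix n n ℂ} (hA : A.IsHermitian) (v w : n → ℂ)
    (hv : quad A v ≠ 0) (a : ℂ) :
    quad A (w + a • v) = quad A w - ‖star v ⬝ᵥ A *ᵥ w‖ ^ 2 / quad A v
      + quad A v * ‖a + (star v ⬝ᵥ A *ᵥ w) / quad A v‖ ^ 2 := by
  have h1 : star w ⬝ᵥ A *ᵥ v = star (star v ⬝ᵥ A *ᵥ w) := (hA.star_dotProduct_mulVec v w).symm
  have h2 := hA.ofReal_quad v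
  have h3 : star (w + a • v) ⬝ᵥ A *ᵥ (w + a • v)
      = star w ⬝ᵥ A *ᵥ w + a * star (star v ⬝ᵥ A *ᵥ w) + star a * (star v ⬝ᵥ A *ᵥ w)
        + star a * a * (quad A v : ℂ) := by
    rw [h2, ← h1]
    simp only [star_add, star_smul, mulVec_add, mulVec_smul, add_dotProduct, dotProduct_add,
      smul_dotProduct, dotProduct_smul, smul_eq_mul]
    ring
  have h4 : quad A (w + a • v) = quad A w + (a * star (star v ⬝ᵥ A *ᵥ w)).re
      + (star a * (star v ⬝ᵥ A *ᵥ w)).re + (star a * a * (quad A v : ℂ)).re := by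
    rw [quad, h3]; simp [quad]
  rw [h4]
  generalize star v ⬝ᵥ A *ᵥ w = z
  rw [← Complex.normSq_eq_norm_sq, ← Complex.normSq_eq_norm_sq]
  generalize quad A v = s at *
  have h5 : z / (s : ℂ) = ((s⁻¹ : ℝ) : ℂ) * z := by push_cast; ring
  rw [h5]
  simp [Complex.normSq_apply, -Complex.ofReal_inv]
  field_simp
  ring

/-- Together with `exists_quad_eq` this presents the Schur complement as the minimum over `a` of the
form along the line w + a v, which is what makes elimination concave. -/
theorem IsHermitian.quad_sub_le {A : Matrix n n ℂ} (hA : A.IsHermitian) (v w : n → ℂ)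
    (hv : 0 < quad A v) (a : ℂ) :
    quad A w - ‖star v ⬝ᵥ A *ᵥ w‖ ^ 2 / quad A v ≤ quad A (w + a • v) := by
  rw [hA.quad_add_smul v w hv.ne' a]
  have : 0 ≤ quad A v * ‖a + (star v ⬝ᵥ A *ᵥ w) / quad A v‖ ^ 2 := by positivity
  linarith

theorem IsHermitian.exists_quad_eq {A : Matrix n n ℂ} (hA : A.IsHermitian) (v w : n → ℂ)
    (hv : 0 < quad A v) :
    ∃ a : ℂ, quad A (w + a • v) = quad A w - ‖star v ⬝ᵥ A *ᵥ w‖ ^ 2 / quad A v :=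
  ⟨-((star v ⬝ᵥ A *ᵥ w) / quad A v), by rw [hA.quad_add_smul v w hv.ne']; simp⟩

theorem traceInner_add_left (A B V : Matrix n n ℂ) :
    traceInner (A + B) V = traceInner A V + traceInner B V := by
  simp [traceInner, add_mul]

theorem traceInner_smul_left (r : ℝ) (A V : Matrix n n ℂ) :
    traceInner ((r : ℂ) • A) V = r * traceInner A V := by
  simp [traceInner]

theorem traceInner_sum_left {ι : Type*} (s : Finset ι) (A : ι → Matrix n n ℂ) (V : Matrix n n ℂ) :
    traceInner (∑ i ∈ s, A i) V = ∑ i ∈ s, traceInner (A i) V := by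
  simp [traceInner, Finset.sum_mul, trace_sum]

theorem traceInner_sum_right {ι : Type*} (s : Finset ι) (A : Matrix n n ℂ)
    (V : ι → Matrix n n ℂ) : traceInner A (∑ i ∈ s, V i) = ∑ i ∈ s, traceInner A (V i) := by
  simp [traceInner, Finset.mul_sum, trace_sum]

theorem traceInner_vecMulVec_right (A : Matrix n n ℂ) (v : n → ℂ) :
    traceInner A (vecMulVec v (star v)) = quad A v := by
  rw [traceInner, mul_vecMulVec, trace_vecMulVec, quad, dotProduct_comm]

theorem traceInner_vecMulVec_left (V : Matrix n n ℂ) (v : n → ℂ) :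
    traceInner (vecMulVec v (star v)) V = quad V v := by
  rw [traceInner, trace_mul_comm, ← traceInner, traceInner_vecMulVec_right]

/-- A positive semidefinite V is a sum of matrices v v†, and pairing with v v† evaluates the form at
v. -/
theorem traceInner_mono {A B V : Matrix n n ℂ} (hV : V.PosSemidef)
    (hAB : ∀ w, quad A w ≤ quad B w) : traceInner A V ≤ traceInner B V := by
  obtain ⟨m, v, rfl⟩ := posSemidef_iff_eq_sum_vecMulVec.1 hV
  simp only [traceInner_sum_right, traceInner_vecMulVec_right]
  exact Finset.sum_le_sum fun i _ => hAB _

omit [Fintype n] in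
theorem IsHermitian.ofReal_re_apply {A : Matrix n n ℂ} (hA : A.IsHermitian) (m : n) :
    ((A m m).re : ℂ) = A m m :=
  Complex.conj_eq_iff_re.1 (hA.apply m m)

variable [DecidableEq n]

theorem quad_single (m : n) (z : ℂ) (w : n → ℂ) :
    quad (single m m z) w = z.re * ‖w m‖ ^ 2 := by
  rw [quad, single_mulVec, ← Complex.normSq_eq_norm_sq, Complex.normSq_apply]
  change (star w ⬝ᵥ Pi.single m (z * w m)).re = _
  simp
  ring

theorem quad_diagonal (d : n → ℝ) (w : n → ℂ) :
    quad (diagonal fun m => (d m : ℂ)) w = ∑ m, d m * ‖w m‖ ^ 2 := by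
  simp only [quad, mulVec_diagonal, dotProduct, Complex.re_sum,
    ← Complex.normSq_eq_norm_sq, Complex.normSq_apply]
  refine Finset.sum_congr rfl fun m _ => ?_
  simp
  ring

theorem quad_one (w : n → ℂ) : quad 1 w = ∑ m, ‖w m‖ ^ 2 := by
  simpa using quad_diagonal (fun _ => 1) w

theorem quad_piSingle (A : Matrix n n ℂ) (m : n) : quad A (Pi.single m 1) = (A m m).re := by
  simp [quad]

theorem traceInner_diagonal_left (d : n → ℝ) (V : Matrix n n ℂ) :
    traceInner (diagonal fun m => (d m : ℂ)) V = ∑ m, d m * (V m m).re := by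
  simp [traceInner, trace, diagonal_mul]

/-- The Cauchy–Schwarz inequality for the form of a positive definite matrix and its inverse. -/
theorem PosDef.norm_sq_le {C : Matrix n n ℂ} (hC : C.PosDef) (w h : n → ℂ) :
    ‖star h ⬝ᵥ w‖ ^ 2 ≤ quad C⁻¹ h * quad C w := by
  rcases eq_or_ne h 0 with rfl | hh
  · simp [quad]
  have hdet : IsUnit C.det := (Matrix.isUnit_iff_isUnit_det C).1 hC.isUnit
  have hCy : C *ᵥ (C⁻¹ *ᵥ h) = h := by rw [mulVec_mulVec, mul_nonsing_inv _ hdet, one_mulVec]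
  have hs : quad C (C⁻¹ *ᵥ h) = quad C⁻¹ h := by
    rw [quad, hCy, quad, star_mulVec, hC.inv.isHermitian.eq, dotProduct_mulVec]
  have hpos : 0 < quad C⁻¹ h := (Complex.lt_def.1 (hC.inv.dotProduct_mulVec_pos hh)).1
  -- Nonnegativity of the form at its minimum along C⁻¹h, where the form of C equals h†C⁻¹h, is the
  -- claimed inequality.
  obtain ⟨a, ha⟩ := hC.isHermitian.exists_quad_eq (C⁻¹ *ᵥ h) w (by rwa [hs])
  have hz : star (C⁻¹ *ᵥ h) ⬝ᵥ C *ᵥ w = star h ⬝ᵥ w := by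
    rw [dotProduct_mulVec, star_mulVec, hC.inv.isHermitian.eq, vecMul_vecMul,
      nonsing_inv_mul _ hdet, vecMul_one]
  have h0 := hC.posSemidef.quad_nonneg (w + a • (C⁻¹ *ᵥ h))
  rw [ha, hs, hz, sub_nonneg, div_le_iff₀ hpos] at h0
  linarith

end Matrix

namespace Network

open Matrix

variable {M K : ℕ} (N : Network M K)

/-! ### The elimination steps -/

/-- The matrix `S + S_mm / (2^cap_m - 1) E_m` whose `m`-th row and column are eliminated. -/
def elimBase (m : Fin M) (S : Matrix (Fin M) (Fin M) ℂ) : Matrix (Fin M) (Fin M) ℂ :=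
  S + Matrix.single m m (S m m / (((2 : ℝ) ^ N.cap m - 1 : ℝ) : ℂ))

/-- The remainder after one elimination step. -/
def elimRem (m : Fin M) (S : Matrix (Fin M) (Fin M) ℂ) : Matrix (Fin M) (Fin M) ℂ :=
  S + Matrix.single m m (N.elim m S m m) - (((2 : ℝ) ^ N.cap m : ℝ) : ℂ) • N.elim m S

theorem remainder_succ (x : EuclideanSpace ℝ (Fin M)) (β : EuclideanSpace ℝ (Fin K)) {n : ℕ}
    (hn : n < M) : N.remainder x β (n + 1) = N.elimRem ⟨n, hn⟩ (N.remainder x β n) := by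
  simp [remainder, hn, elimRem]

theorem two_rpow_cap_sub_one_pos (m : Fin M) : 0 < (2 : ℝ) ^ N.cap m - 1 :=
  sub_pos.2 (Real.one_lt_rpow one_lt_two (N.cap_pos m))

variable {N} {m : Fin M} {S : Matrix (Fin M) (Fin M) ℂ}

theorem quad_elimBase (w : Fin M → ℂ) :
    quad (N.elimBase m S) w = quad S w + (S m m).re / ((2 : ℝ) ^ N.cap m - 1) * ‖w m‖ ^ 2 := by
  rw [elimBase, quad_add, quad_single, Complex.div_ofReal_re]

theorem isHermitian_elimBase (hS : S.IsHermitian) : (N.elimBase m S).IsHermitian := by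
  refine hS.add ?_
  rw [IsHermitian, conjTranspose_single]
  congr 1
  rw [← hS.ofReal_re_apply m, ← Complex.ofReal_div]
  exact Complex.conj_ofReal _

theorem elimBase_diag (hS : S.IsHermitian) : N.elimBase m S m m
    = (((S m m).re / ((2 : ℝ) ^ N.cap m - 1) * (2 : ℝ) ^ N.cap m : ℝ) : ℂ) := by
  have h := N.two_rpow_cap_sub_one_pos m
  rw [elimBase, Matrix.add_apply, single_apply_same, ← hS.ofReal_re_apply m, ← Complex.ofReal_div,
    ← Complex.ofReal_add, Complex.ofReal_inj]
  simp only [Complex.ofReal_re]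
  field_simp
  ring

theorem elimBase_apply_of_ne {i : Fin M} (h : i ≠ m) (j : Fin M) : N.elimBase m S i j = S i j := by
  simp [elimBase, single_apply_of_row_ne h.symm]

/-- The eliminated matrix is a rank-one positive matrix. -/
theorem elim_eq (hS : S.IsHermitian) (hm : 0 < (S m m).re) :
    N.elim m S = (((S m m).re / ((2 : ℝ) ^ N.cap m - 1) : ℝ) : ℂ) •
      vecMulVec (fun i => N.elimBase m S i m / N.elimBase m S m m)
        (star fun i => N.elimBase m S i m / N.elimBase m S m m) := by
  have h := N.two_rpow_cap_sub_one_pos m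
  have h2 : (0 : ℝ) < 2 ^ N.cap m := by positivity
  ext i j
  have hj : star (N.elimBase m S j m) = N.elimBase m S m j := (isHermitian_elimBase hS).apply m j
  simp only [elim, ← elimBase.eq_1, Matrix.smul_apply, vecMulVec_apply, Pi.star_apply, star_div₀,
    hj, elimBase_diag hS, smul_eq_mul]
  rw [show star (((S m m).re / ((2 : ℝ) ^ N.cap m - 1) * (2 : ℝ) ^ N.cap m : ℝ) : ℂ) = _ from
    Complex.conj_ofReal _]
  have e1 : (((2 : ℝ) ^ N.cap m : ℝ) : ℂ) ≠ 0 := by exact_mod_cast h2.ne'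
  have e2 : ((((2 : ℝ) ^ N.cap m - 1 : ℝ)) : ℂ) ≠ 0 := by exact_mod_cast h.ne'
  have e3 : ((S m m).re : ℂ) ≠ 0 := by exact_mod_cast hm.ne'
  generalize (2 : ℝ) ^ N.cap m = c at *
  generalize N.elimBase m S = T at *
  rw [Complex.ofReal_mul, Complex.ofReal_div]
  generalize ((c - 1 : ℝ) : ℂ) = d at *
  field_simp

theorem elim_diag (hS : S.IsHermitian) (hm : 0 < (S m m).re) :
    N.elim m S m m = (((S m m).re / ((2 : ℝ) ^ N.cap m - 1) : ℝ) : ℂ) := by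
  have h := N.two_rpow_cap_sub_one_pos m
  have hT : N.elimBase m S m m ≠ 0 := by
    rw [elimBase_diag hS]
    exact_mod_cast (by positivity : 0 < (S m m).re / ((2 : ℝ) ^ N.cap m - 1) * 2 ^ N.cap m).ne'
  rw [elim_eq hS hm]
  simp [vecMulVec_apply, hT]

/-- Since Λ_mm = S_mm / (2^cap_m − 1), adding Λ_mm E_m to S produces `elimBase`, and 2^cap_m Λ is
the outer product of its m-th column over the pivot. The remainder is thus the Schur complement of
`elimBase` at m. -/
theorem elimRem_eq (hS : S.IsHermitian) (hm : 0 < (S m m).re) :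
    N.elimRem m S = N.elimBase m S
      - ((((S m m).re / ((2 : ℝ) ^ N.cap m - 1) * 2 ^ N.cap m)⁻¹ : ℝ) : ℂ) • vecMulVec (fun i => N.elimBase m S i m) (star fun i => N.elimBase m S i m) := by
  have h := N.two_rpow_cap_sub_one_pos m
  have h2 : (0 : ℝ) < 2 ^ N.cap m := by positivity
  have e2 : (((2 : ℝ) ^ N.cap m : ℝ) : ℂ) ≠ 0 := by exact_mod_cast h2.ne'
  rw [elimRem, elim_diag hS hm, elimBase, Complex.ofReal_div, hS.ofReal_re_apply, ← elimBase.eq_1]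
  congr 1
  ext i j
  have hj : star (N.elimBase m S j m) = N.elimBase m S m j := (isHermitian_elimBase hS).apply m j
  simp only [elim, ← elimBase.eq_1, Matrix.smul_apply, vecMulVec_apply, Pi.star_apply, hj,
    elimBase_diag hS, smul_eq_mul, Complex.ofReal_inv]
  have e3 : (((S m m).re / ((2 : ℝ) ^ N.cap m - 1) * 2 ^ N.cap m : ℝ) : ℂ) ≠ 0 := by
    exact_mod_cast (by positivity : 0 < (S m m).re / ((2 : ℝ) ^ N.cap m - 1) * 2 ^ N.cap m).ne'
  generalize (((S m m).re / ((2 : ℝ) ^ N.cap m - 1) * 2 ^ N.cap m : ℝ) : ℂ) = t at *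
  field_simp

theorem quad_elimRem (hS : S.IsHermitian) (hm : 0 < (S m m).re) (w : Fin M → ℂ) :
    quad (N.elimRem m S) w = quad (N.elimBase m S) w
      - ‖star (Pi.single m 1) ⬝ᵥ N.elimBase m S *ᵥ w‖ ^ 2
        / quad (N.elimBase m S) (Pi.single m 1) := by
  have hv : star (Pi.single m 1) ⬝ᵥ N.elimBase m S *ᵥ w
      = star (fun i => N.elimBase m S i m) ⬝ᵥ w := by
    have : star (fun i => N.elimBase m S i m) = N.elimBase m S m := by
      ext j; exact (isHermitian_elimBase hS).apply m j
    rw [this]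
    simp [mulVec]
  rw [elimRem_eq hS hm, quad_sub, quad_smul, quad_vecMulVec, hv, quad_piSingle, elimBase_diag hS,
    Complex.ofReal_re]
  ring

theorem isHermitian_elimRem (hS : S.IsHermitian) (hm : 0 < (S m m).re) :
    (N.elimRem m S).IsHermitian := by
  rw [elimRem_eq hS hm]
  refine (isHermitian_elimBase hS).sub ?_
  rw [IsHermitian, conjTranspose_smul, conjTranspose_vecMulVec, star_star]
  congr 1
  exact Complex.conj_ofReal _

theorem elimBase_quad_single_pos (hm : 0 < (S m m).re) :
    0 < quad (N.elimBase m S) (Pi.single m 1) := by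
  have h := N.two_rpow_cap_sub_one_pos m
  rw [quad_elimBase, quad_piSingle]
  positivity

theorem quad_elimRem_le (hS : S.IsHermitian) (hm : 0 < (S m m).re) (w : Fin M → ℂ) (a : ℂ) :
    quad (N.elimRem m S) w ≤ quad (N.elimBase m S) (w + a • Pi.single m 1) := by
  rw [quad_elimRem hS hm]
  exact (isHermitian_elimBase hS).quad_sub_le _ _ (elimBase_quad_single_pos hm) a

theorem exists_quad_elimRem_eq (hS : S.IsHermitian) (hm : 0 < (S m m).re) (w : Fin M → ℂ) :
    ∃ a : ℂ, quad (N.elimRem m S) w = quad (N.elimBase m S) (w + a • Pi.single m 1) := by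
  obtain ⟨a, ha⟩ := (isHermitian_elimBase (N := N) hS).exists_quad_eq (Pi.single m 1) w
    (elimBase_quad_single_pos hm)
  exact ⟨a, by rw [ha, quad_elimRem hS hm]⟩

/-- In an earlier row the column entry of `elimBase` is zero, so nothing is subtracted; in row m the
Schur complement cancels everything. -/
theorem elimRem_row_eq_zero (hS : S.IsHermitian) (hm : 0 < (S m m).re) {n : ℕ} (hn : (m : ℕ) = n)
    (h0 : ∀ i j : Fin M, (i : ℕ) < n → S i j = 0) (i j : Fin M) (hi : (i : ℕ) < n + 1) :
    N.elimRem m S i j = 0 := by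
  have h := N.two_rpow_cap_sub_one_pos m
  have hT : N.elimBase m S m m ≠ 0 := by
    rw [elimBase_diag hS]
    exact_mod_cast (by positivity : 0 < (S m m).re / ((2 : ℝ) ^ N.cap m - 1) * 2 ^ N.cap m).ne'
  have hj : star (N.elimBase m S j m) = N.elimBase m S m j := (isHermitian_elimBase hS).apply m j
  rw [elimRem_eq hS hm, Complex.ofReal_inv, ← elimBase_diag hS]
  simp only [Matrix.sub_apply, Matrix.smul_apply, vecMulVec_apply, Pi.star_apply, hj, smul_eq_mul]
  rcases Nat.lt_succ_iff_lt_or_eq.1 hi with h | h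
  · have hne : i ≠ m := by rintro rfl; omega
    rw [elimBase_apply_of_ne hne, elimBase_apply_of_ne hne, h0 i j h, h0 i m h]
    simp
  · obtain rfl : i = m := Fin.ext (h.trans hn.symm)
    field_simp
    simp

/-! ### Definiteness and superadditivity of the remainders -/

variable {x : EuclideanSpace ℝ (Fin M)} {β : EuclideanSpace ℝ (Fin K)}

theorem quad_baseMat (w : Fin M → ℂ) : quad (N.baseMat x β) w
    = ∑ m, (1 + x m) * ‖w m‖ ^ 2 + ∑ k, β k * ‖star (N.h k) ⬝ᵥ w‖ ^ 2 := by
  simp only [baseMat, quad_add, quad_one, quad_diagonal, quad_sum, quad_smul, quad_vecMulVec,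
    ← Finset.sum_add_distrib]
  simp only [add_mul, one_mul]

theorem isHermitian_baseMat : (N.baseMat x β).IsHermitian := by
  refine (isHermitian_one.add (isHermitian_diagonal_of_self_adjoint _ ?_)).add ?_
  · ext m; exact Complex.conj_ofReal _
  · rw [IsHermitian, conjTranspose_sum]
    refine Finset.sum_congr rfl fun k _ => ?_
    rw [conjTranspose_smul, conjTranspose_vecMulVec, star_star]
    congr 1
    exact Complex.conj_ofReal _

/-- The invariants that keep the elimination going: the lower bound makes the next pivot positive.
It survives a step because partial minimization changes only coordinate n, which the bound at n + 1
no longer counts. The parameter ε admits slightly negative x, as needed for differentiability at the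
boundary of the orthant. -/
theorem remainder_spec {ε : ℝ} (hε : 0 < ε) (hx : ∀ m, ε ≤ 1 + x m) (hβ : ∀ k, 0 ≤ β k) (n : ℕ)
    (hn : n ≤ M) : (N.remainder x β n).IsHermitian ∧
      (∀ i j : Fin M, (i : ℕ) < n → N.remainder x β n i j = 0) ∧
      ∀ w, ε * ∑ i : Fin M, (if n ≤ i then ‖w i‖ ^ 2 else 0) ≤ quad (N.remainder x β n) w := by
  induction n with
  | zero =>
    refine ⟨isHermitian_baseMat, fun _ _ h => absurd h (Nat.not_lt_zero _), fun w => ?_⟩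
    rw [remainder, quad_baseMat, Finset.mul_sum]
    have h1 : 0 ≤ ∑ k, β k * ‖star (N.h k) ⬝ᵥ w‖ ^ 2 :=
      Finset.sum_nonneg fun k _ => mul_nonneg (hβ k) (by positivity)
    have h2 : ∑ i : Fin M, ε * (if 0 ≤ (i : ℕ) then ‖w i‖ ^ 2 else 0)
        ≤ ∑ m, (1 + x m) * ‖w m‖ ^ 2 :=
      Finset.sum_le_sum fun m _ => by
        simp only [Nat.zero_le, if_true]
        exact mul_le_mul_of_nonneg_right (hx m) (by positivity)
    linarith
  | succ n ih =>
    have hn' : n < M := hn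
    obtain ⟨h1, h2, h3⟩ := ih hn'.le
    have hm : 0 < (N.remainder x β n ⟨n, hn'⟩ ⟨n, hn'⟩).re := by
      rw [← quad_piSingle]
      refine lt_of_lt_of_le ?_ (h3 _)
      refine mul_pos hε ?_
      refine Finset.sum_pos' (fun i _ => by positivity) ⟨⟨n, hn'⟩, Finset.mem_univ _, ?_⟩
      simp
    rw [remainder_succ N x β hn']
    refine ⟨isHermitian_elimRem h1 hm, elimRem_row_eq_zero h1 hm rfl h2, fun w => ?_⟩
    obtain ⟨a, ha⟩ := exists_quad_elimRem_eq (N := N) h1 hm w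
    rw [ha, quad_elimBase]
    have h := N.two_rpow_cap_sub_one_pos ⟨n, hn'⟩
    refine le_trans ?_ (le_add_of_nonneg_right (by positivity))
    refine le_trans ?_ (h3 _)
    refine mul_le_mul_of_nonneg_left (Finset.sum_le_sum fun i _ => ?_) hε.le
    by_cases hi : n + 1 ≤ (i : ℕ)
    · have hne : i ≠ ⟨n, hn'⟩ := by rintro rfl; simp at hi
      simp [hi, (Nat.le_succ n).trans hi, hne]
    · rw [if_neg hi]
      positivity

theorem isHermitian_remainder {ε : ℝ} (hε : 0 < ε) (hx : ∀ m, ε ≤ 1 + x m) (hβ : ∀ k, 0 ≤ β k)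
    (m : Fin M) : (N.remainder x β m).IsHermitian :=
  (remainder_spec hε hx hβ m m.2.le).1

theorem remainder_diag_pos {ε : ℝ} (hε : 0 < ε) (hx : ∀ m, ε ≤ 1 + x m) (hβ : ∀ k, 0 ≤ β k)
    (m : Fin M) : 0 < (N.remainder x β m m m).re := by
  rw [← quad_piSingle]
  refine lt_of_lt_of_le ?_ ((remainder_spec hε hx hβ m m.2.le).2.2 _)
  refine mul_pos hε ?_
  refine Finset.sum_pos' (fun i _ => by positivity) ⟨m, Finset.mem_univ _, ?_⟩
  simp

/-- Superadditivity and homogeneity of the elimination, for the base matrices. -/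
theorem quad_remainder_superadd {ε : ℝ} (hε : 0 < ε) (hx : ∀ m, ε ≤ 1 + x m)
    {β' : EuclideanSpace ℝ (Fin K)} (hβ : ∀ k, 0 ≤ β k) (hβ' : ∀ k, 0 ≤ β' k) {α : ℝ} (hα : 1 ≤ α)
    (h : ∀ k, β k ≤ α * β' k) (n : ℕ) (hn : n ≤ M) (w : Fin M → ℂ) :
    quad (N.remainder x β n) w + (α - 1) * quad (N.remainder x 0 n) w
      ≤ α * quad (N.remainder x β' n) w := by
  induction n generalizing w with
  | zero =>
    simp only [remainder, quad_baseMat]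
    have h1 : ∑ k, β k * ‖star (N.h k) ⬝ᵥ w‖ ^ 2 ≤ α * ∑ k, β' k * ‖star (N.h k) ⬝ᵥ w‖ ^ 2 := by
      rw [Finset.mul_sum]
      refine Finset.sum_le_sum fun k _ => ?_
      rw [← mul_assoc]
      exact mul_le_mul_of_nonneg_right (h k) (by positivity)
    simp only [PiLp.zero_apply, zero_mul, Finset.sum_const_zero]
    linarith
  | succ n ih =>
    have hn' : n < M := hn
    have h0 : ∀ k, 0 ≤ (0 : EuclideanSpace ℝ (Fin K)) k := fun k => le_rfl
    simp only [remainder_succ N _ _ hn']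
    -- The minimizer for β' serves as a competitor for β and for 0, so that all three forms are
    -- compared at one vector.
    obtain ⟨a, ha⟩ := exists_quad_elimRem_eq (N := N)
      (isHermitian_remainder (N := N) hε hx hβ' ⟨n, hn'⟩) (remainder_diag_pos hε hx hβ' ⟨n, hn'⟩) w
    have h1 := quad_elimRem_le (N := N) (isHermitian_remainder (N := N) hε hx hβ ⟨n, hn'⟩)
      (remainder_diag_pos hε hx hβ ⟨n, hn'⟩) w a
    have h2 := quad_elimRem_le (N := N) (isHermitian_remainder (N := N) hε hx h0 ⟨n, hn'⟩)
      (remainder_diag_pos hε hx h0 ⟨n, hn'⟩) w a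
    simp only at ha h1 h2
    rw [ha]
    rw [quad_elimBase] at h1 h2 ⊢
    have h3 := ih hn'.le (w + a • Pi.single ⟨n, hn'⟩ 1)
    -- The weight of the extra term in `elimBase` is the form at the n-th unit vector, so the
    -- induction hypothesis covers it too.
    have h4 := ih hn'.le (Pi.single ⟨n, hn'⟩ 1)
    simp only [quad_piSingle] at h4
    have hc := N.two_rpow_cap_sub_one_pos ⟨n, hn'⟩
    have h5 := mul_le_mul_of_nonneg_right h4
      (by positivity : 0 ≤ ((2 : ℝ) ^ N.cap ⟨n, hn'⟩ - 1)⁻¹ *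
        ‖(w + a • Pi.single (⟨n, hn'⟩ : Fin M) (1 : ℂ) : Fin M → ℂ) ⟨n, hn'⟩‖ ^ 2)
    have h6 := mul_le_mul_of_nonneg_left h2 (sub_nonneg.2 hα)
    simp only [div_eq_mul_inv] at *
    nlinarith

end Network

namespace Network

open Matrix

variable {M K : ℕ} {N : Network M K}

/-! ### The multipliers of the fronthaul constraints -/

variable {x : EuclideanSpace ℝ (Fin M)} {β : EuclideanSpace ℝ (Fin K)} {ε : ℝ}

variable (N x β) in
/-- The `m`-th diagonal entry of `Λ_{x,m}(β)`. -/
def lamDiag (m : Fin M) : ℝ := (N.Lam x β m m m).re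

variable (N x β) in
/-- The vector `v` with `v_m = 1` for which `Λ_{x,m}(β)` is a multiple of `v v†`. -/
def lamVec (m : Fin M) : Fin M → ℂ := Pi.single m 1 + N.tailVec β x m

theorem lamDiag_eq (hε : 0 < ε) (hx : ∀ m, ε ≤ 1 + x m) (hβ : ∀ k, 0 ≤ β k) (m : Fin M) :
    N.lamDiag x β m = (N.remainder x β m m m).re / ((2 : ℝ) ^ N.cap m - 1) := by
  rw [lamDiag, Lam, elim_diag (isHermitian_remainder hε hx hβ m) (remainder_diag_pos hε hx hβ m),
    Complex.ofReal_re]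

theorem lamDiag_pos (hε : 0 < ε) (hx : ∀ m, ε ≤ 1 + x m) (hβ : ∀ k, 0 ≤ β k) (m : Fin M) :
    0 < N.lamDiag x β m := by
  rw [lamDiag_eq hε hx hβ]
  exact div_pos (remainder_diag_pos hε hx hβ m) (N.two_rpow_cap_sub_one_pos m)

theorem Lam_diag (hε : 0 < ε) (hx : ∀ m, ε ≤ 1 + x m) (hβ : ∀ k, 0 ≤ β k) (m : Fin M) :
    N.Lam x β m m m = (N.lamDiag x β m : ℂ) := by
  rw [lamDiag, Lam, elim_diag (isHermitian_remainder hε hx hβ m) (remainder_diag_pos hε hx hβ m),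
    Complex.ofReal_re]

theorem lamVec_apply_of_lt {m i : Fin M} (h : i < m) : N.lamVec x β m i = 0 := by
  simp [lamVec, tailVec, h.ne, h.not_gt]

theorem lamVec_apply_self (m : Fin M) : N.lamVec x β m m = 1 := by
  simp [lamVec, tailVec]

theorem Lam_eq (hε : 0 < ε) (hx : ∀ m, ε ≤ 1 + x m) (hβ : ∀ k, 0 ≤ β k) (m : Fin M) :
    N.Lam x β m
      = (N.lamDiag x β m : ℂ) • vecMulVec (N.lamVec x β m) (star (N.lamVec x β m)) := by
  have hS := isHermitian_remainder (N := N) hε hx hβ m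
  have hm := remainder_diag_pos (N := N) hε hx hβ m
  have hpos := lamDiag_pos (N := N) hε hx hβ m
  have hne : (N.lamDiag x β m : ℂ) ≠ 0 := by exact_mod_cast hpos.ne'
  have h := N.two_rpow_cap_sub_one_pos m
  have hT : N.elimBase m (N.remainder x β m) m m ≠ 0 := by
    rw [elimBase_diag hS]
    exact_mod_cast (by positivity : 0 < (N.remainder x β m m m).re / ((2 : ℝ) ^ N.cap m - 1)
      * 2 ^ N.cap m).ne'
  have key := elim_eq (N := N) hS hm
  rw [← Lam.eq_1, ← lamDiag_eq hε hx hβ m] at key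
  have hv : (fun i => N.elimBase m (N.remainder x β m) i m / N.elimBase m (N.remainder x β m) m m)
      = N.lamVec x β m := by
    ext i
    rcases lt_trichotomy i m with hi | rfl | hi
    · rw [lamVec_apply_of_lt hi, elimBase_apply_of_ne hi.ne,
        (remainder_spec hε hx hβ m m.2.le).2.1 i m hi, zero_div]
    · rw [lamVec_apply_self, div_self hT]
    · simp only [lamVec, tailVec, Pi.add_apply, Pi.single_apply, hi.ne', if_false, hi, if_true,
        zero_add]
      rw [Lam_diag hε hx hβ m, key]
      simp [vecMulVec_apply, hT]
      field_simp
  rwa [hv] at key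

theorem remainder_eq_sum (n : ℕ) (hn : n ≤ M) : N.remainder x β n = N.baseMat x β
    + ∑ m : Fin M, if (m : ℕ) < n then Matrix.single m m (N.Lam x β m m m)
      - (((2 : ℝ) ^ N.cap m : ℝ) : ℂ) • N.Lam x β m else 0 := by
  induction n with
  | zero => simp [remainder]
  | succ n ih =>
    have hn' : n < M := hn
    rw [remainder_succ N x β hn', elimRem]
    have h1 : ∀ m : Fin M, (if (m : ℕ) < n + 1 then Matrix.single m m (N.Lam x β m m m)
        - (((2 : ℝ) ^ N.cap m : ℝ) : ℂ) • N.Lam x β m else 0)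
        = (if (m : ℕ) < n then Matrix.single m m (N.Lam x β m m m)
        - (((2 : ℝ) ^ N.cap m : ℝ) : ℂ) • N.Lam x β m else 0)
        + if m = ⟨n, hn'⟩ then Matrix.single m m (N.Lam x β m m m)
        - (((2 : ℝ) ^ N.cap m : ℝ) : ℂ) • N.Lam x β m else 0 := by
      intro m
      rcases lt_trichotomy (m : ℕ) n with h | h | h
      · have : m ≠ ⟨n, hn'⟩ := by rintro rfl; simp at h
        simp [h, h.trans (Nat.lt_succ_self n), this]
      · obtain rfl : m = ⟨n, hn'⟩ := Fin.ext h
        simp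
      · have : m ≠ ⟨n, hn'⟩ := by rintro rfl; simp at h
        simp [h.not_gt, this, (Nat.succ_le_of_lt h).not_gt]
    simp only [h1, Finset.sum_add_distrib, Finset.sum_ite_eq', Finset.mem_univ, if_true]
    rw [← add_assoc, ← ih hn'.le]
    simp only [Lam]
    abel

/-- After M steps all rows are eliminated, so the telescoped remainder is zero; rearranging gives
the defining equation of the Λ_m. -/
theorem sum_Lam (hε : 0 < ε) (hx : ∀ m, ε ≤ 1 + x m) (hβ : ∀ k, 0 ≤ β k) :
    N.Cmat x β = ∑ m, (((2 : ℝ) ^ N.cap m : ℝ) : ℂ) • N.Lam x β m := by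
  have h0 : N.remainder x β M = 0 := by
    ext i j
    exact (remainder_spec hε hx hβ M le_rfl).2.1 i j i.2
  rw [remainder_eq_sum M le_rfl] at h0
  simp only [Fin.is_lt, if_true, Finset.sum_sub_distrib] at h0
  rw [Cmat, ← sum_single_eq_diagonal, ← sub_eq_zero, ← h0]
  abel

theorem Cmat_eq (hε : 0 < ε) (hx : ∀ m, ε ≤ 1 + x m) (hβ : ∀ k, 0 ≤ β k) :
    N.Cmat x β = N.baseMat x β + Matrix.diagonal fun m => (N.lamDiag x β m : ℂ) := by
  rw [Cmat]
  congr 2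
  ext m
  exact Lam_diag hε hx hβ m

theorem isHermitian_Cmat (hε : 0 < ε) (hx : ∀ m, ε ≤ 1 + x m) (hβ : ∀ k, 0 ≤ β k) :
    (N.Cmat x β).IsHermitian := by
  rw [Cmat_eq hε hx hβ]
  refine isHermitian_baseMat.add (isHermitian_diagonal_of_self_adjoint _ ?_)
  ext m; exact Complex.conj_ofReal _

theorem quad_Cmat (hε : 0 < ε) (hx : ∀ m, ε ≤ 1 + x m) (hβ : ∀ k, 0 ≤ β k) (w : Fin M → ℂ) :
    quad (N.Cmat x β) w = quad (N.baseMat x β) w + ∑ m, N.lamDiag x β m * ‖w m‖ ^ 2 := by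
  rw [Cmat_eq hε hx hβ, quad_add, quad_diagonal]

theorem le_quad_Cmat (hε : 0 < ε) (hx : ∀ m, ε ≤ 1 + x m) (hβ : ∀ k, 0 ≤ β k) (w : Fin M → ℂ) :
    ε * ∑ m, ‖w m‖ ^ 2 ≤ quad (N.Cmat x β) w := by
  rw [quad_Cmat hε hx hβ]
  have h1 := (remainder_spec (N := N) hε hx hβ 0 (Nat.zero_le M)).2.2 w
  simp only [Nat.zero_le, if_true, remainder] at h1
  have h2 : 0 ≤ ∑ m, N.lamDiag x β m * ‖w m‖ ^ 2 :=
    Finset.sum_nonneg fun m _ => mul_nonneg (lamDiag_pos hε hx hβ m).le (by positivity)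
  linarith

theorem sum_norm_sq_pos {w : Fin M → ℂ} (hw : w ≠ 0) : 0 < ∑ m, ‖w m‖ ^ 2 := by
  obtain ⟨i, hi⟩ := Function.ne_iff.1 hw
  refine Finset.sum_pos' (fun m _ => by positivity) ⟨i, Finset.mem_univ _, ?_⟩
  have : 0 < ‖w i‖ := norm_pos_iff.2 hi
  positivity

theorem posDef_Cmat (hε : 0 < ε) (hx : ∀ m, ε ≤ 1 + x m) (hβ : ∀ k, 0 ≤ β k) :
    (N.Cmat x β).PosDef := by
  have hH := isHermitian_Cmat (N := N) hε hx hβ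
  refine .of_dotProduct_mulVec_pos hH fun w hw => ?_
  rw [← hH.ofReal_quad]
  exact_mod_cast (mul_pos hε (sum_norm_sq_pos hw)).trans_le (le_quad_Cmat hε hx hβ w)

/-- The diagonal entries of the Λ_m are values of the remainder forms at unit vectors divided by
positive constants, so they inherit superadditivity. -/
theorem quad_Cmat_superadd (hε : 0 < ε) (hx : ∀ m, ε ≤ 1 + x m)
    {β' : EuclideanSpace ℝ (Fin K)} (hβ : ∀ k, 0 ≤ β k) (hβ' : ∀ k, 0 ≤ β' k) {α : ℝ} (hα : 1 ≤ α)
    (h : ∀ k, β k ≤ α * β' k) (w : Fin M → ℂ) :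
    quad (N.Cmat x β) w + (α - 1) * quad (N.Cmat x 0) w ≤ α * quad (N.Cmat x β') w := by
  have h0 : ∀ k, 0 ≤ (0 : EuclideanSpace ℝ (Fin K)) k := fun k => le_rfl
  rw [quad_Cmat hε hx hβ, quad_Cmat hε hx hβ', quad_Cmat hε hx h0]
  have h1 := quad_remainder_superadd (N := N) hε hx hβ hβ' hα h 0 (Nat.zero_le M) w
  simp only [remainder] at h1
  have h2 : ∑ m, N.lamDiag x β m * ‖w m‖ ^ 2 + (α - 1) * ∑ m, N.lamDiag x 0 m * ‖w m‖ ^ 2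
      ≤ α * ∑ m, N.lamDiag x β' m * ‖w m‖ ^ 2 := by
    rw [Finset.mul_sum, Finset.mul_sum, ← Finset.sum_add_distrib]
    refine Finset.sum_le_sum fun m _ => ?_
    have h3 := quad_remainder_superadd (N := N) hε hx hβ hβ' hα h m m.2.le (Pi.single m 1)
    simp only [quad_piSingle] at h3
    have h4 := mul_le_mul_of_nonneg_right h3 (by have := N.two_rpow_cap_sub_one_pos m; positivity :
      0 ≤ ((2 : ℝ) ^ N.cap m - 1)⁻¹ * ‖w m‖ ^ 2)
    rw [lamDiag_eq hε hx hβ, lamDiag_eq hε hx hβ', lamDiag_eq hε hx h0]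
    simp only [div_eq_mul_inv]
    linarith
  linarith

/-! ### The mapping `I_x` -/

theorem h_ne_zero (hN : N.StrictlyFeasible) (k : Fin K) : N.h k ≠ 0 := by
  obtain ⟨V, Q, -, -, hs, -⟩ := hN
  intro h0
  have := hs k
  simp only [sinrLHS, h0, mulVec_zero, dotProduct_zero, Complex.zero_re] at this
  exact this.not_gt (N.σsq_pos k)

theorem Imap_apply (k : Fin K) : N.Imap x β k
    = N.γ k / (N.γ k + 1) * (1 / quad (N.Cmat x β)⁻¹ (N.h k)) := rfl

theorem quad_inv_pos {C : Matrix (Fin M) (Fin M) ℂ} (hC : C.PosDef) {h : Fin M → ℂ} (hh : h ≠ 0) :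
    0 < quad C⁻¹ h :=
  (Complex.lt_def.1 (hC.inv.dotProduct_mulVec_pos hh)).1

theorem mulVec_inv_mulVec {C : Matrix (Fin M) (Fin M) ℂ} (hC : C.PosDef) (h : Fin M → ℂ) :
    C *ᵥ (C⁻¹ *ᵥ h) = h := by
  rw [mulVec_mulVec, mul_nonsing_inv _ ((Matrix.isUnit_iff_isUnit_det C).1 hC.isUnit), one_mulVec]

theorem dotProduct_inv_mulVec {C : Matrix (Fin M) (Fin M) ℂ} (hC : C.PosDef) (h : Fin M → ℂ) :
    star h ⬝ᵥ C⁻¹ *ᵥ h = (quad C⁻¹ h : ℂ) :=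
  (hC.inv.isHermitian.ofReal_quad h).symm

theorem quad_inv_mulVec {C : Matrix (Fin M) (Fin M) ℂ} (hC : C.PosDef) (h : Fin M → ℂ) :
    quad C (C⁻¹ *ᵥ h) = quad C⁻¹ h := by
  rw [quad, mulVec_inv_mulVec hC, quad, star_mulVec, hC.inv.isHermitian.eq, dotProduct_mulVec]

theorem norm_dotProduct_sq_le (v w : Fin M → ℂ) :
    ‖star v ⬝ᵥ w‖ ^ 2 ≤ (∑ m, ‖v m‖ ^ 2) * ∑ m, ‖w m‖ ^ 2 := by
  have := (PosDef.one (n := Fin M) (R := ℂ)).norm_sq_le w v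
  rwa [inv_one, quad_one, quad_one] at this

/-- This is the variational description of 1/(h†C⁻¹h): it is the largest t with t h h† ≼ C, and
equality holds at w = C⁻¹h. -/
theorem norm_sq_mul_inv_le {C : Matrix (Fin M) (Fin M) ℂ} (hC : C.PosDef) {h : Fin M → ℂ}
    (hh : h ≠ 0) (w : Fin M → ℂ) : ‖star h ⬝ᵥ w‖ ^ 2 * (1 / quad C⁻¹ h) ≤ quad C w := by
  rw [mul_one_div, div_le_iff₀ (quad_inv_pos hC hh), mul_comm]
  exact hC.norm_sq_le w h

theorem quad_inv_Cmat_le (hε : 0 < ε) (hx : ∀ m, ε ≤ 1 + x m) (hβ : ∀ k, 0 ≤ β k)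
    {h : Fin M → ℂ} (hh : h ≠ 0) :
    ε / ∑ m, ‖h m‖ ^ 2 ≤ 1 / quad (N.Cmat x β)⁻¹ h := by
  have hC := posDef_Cmat (N := N) hε hx hβ
  have hpos := quad_inv_pos hC hh
  have h1 := le_quad_Cmat (N := N) hε hx hβ ((N.Cmat x β)⁻¹ *ᵥ h)
  have h2 := norm_dotProduct_sq_le h ((N.Cmat x β)⁻¹ *ᵥ h)
  rw [quad_inv_mulVec hC] at h1
  rw [dotProduct_inv_mulVec hC, Complex.norm_real, Real.norm_eq_abs, sq_abs] at h2
  have hs := sum_norm_sq_pos hh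
  rw [div_le_div_iff₀ hs hpos, one_mul]
  generalize quad (N.Cmat x β)⁻¹ h = q at *
  nlinarith

/-- A minimum of superadditive forms is superadditive. The constant c comes from I_x(0), which is
bounded below uniformly in x because C ≽ ε I. -/
theorem Imap_isInterference (hN : N.StrictlyFeasible) (hε : 0 < ε) :
    ∃ c, 0 < c ∧ ∀ x : EuclideanSpace ℝ (Fin M), (∀ m, ε ≤ 1 + x m) →
      IsInterference (N.Imap x) c := by
  obtain ⟨c, hc, hck⟩ := exists_pos_forall_le
    (f := fun k => N.γ k / (N.γ k + 1) * (ε / ∑ m, ‖N.h k m‖ ^ 2)) fun k => by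
      have := N.γ_pos k
      have := sum_norm_sq_pos (h_ne_zero hN k)
      positivity
  refine ⟨c, hc, fun x hx β β' α hβ hβ' hα hle k => ?_⟩
  have hh := h_ne_zero hN k
  have hγ := N.γ_pos k
  have h0 : ∀ k, 0 ≤ (0 : EuclideanSpace ℝ (Fin K)) k := fun k => le_rfl
  have hC := posDef_Cmat (N := N) hε hx hβ
  have hC' := posDef_Cmat (N := N) hε hx hβ'
  have hC0 := posDef_Cmat (N := N) hε hx h0
  have hq := quad_inv_pos hC' hh
  -- The test vector is optimal for β' and only a competitor for β and 0.
  have h1 := quad_Cmat_superadd (N := N) hε hx hβ hβ' hα hle ((N.Cmat x β')⁻¹ *ᵥ N.h k)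
  have h2 := norm_sq_mul_inv_le hC hh ((N.Cmat x β')⁻¹ *ᵥ N.h k)
  have h3 := norm_sq_mul_inv_le hC0 hh ((N.Cmat x β')⁻¹ *ᵥ N.h k)
  rw [quad_inv_mulVec hC'] at h1
  rw [dotProduct_inv_mulVec hC', Complex.norm_real, Real.norm_eq_abs, sq_abs] at h2 h3
  have h4 := mul_le_mul_of_nonneg_left h3 (sub_nonneg.2 hα)
  have h5 := quad_inv_Cmat_le (N := N) hε hx h0 hh
  have hck' := hck k
  simp only [Imap_apply]
  have h6 : c ≤ N.γ k / (N.γ k + 1) * (1 / quad (N.Cmat x 0)⁻¹ (N.h k)) :=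
    hck'.trans (mul_le_mul_of_nonneg_left h5 (by positivity))
  have h7 : 1 / quad (N.Cmat x β)⁻¹ (N.h k) + (α - 1) * (1 / quad (N.Cmat x 0)⁻¹ (N.h k))
      ≤ α * (1 / quad (N.Cmat x β')⁻¹ (N.h k)) := by
    generalize quad (N.Cmat x β')⁻¹ (N.h k) = q at *
    rw [mul_one_div α q, le_div_iff₀ hq]
    refine le_of_mul_le_mul_left ?_ hq
    nlinarith
  have h8 := mul_le_mul_of_nonneg_left h7 (by positivity : 0 ≤ N.γ k / (N.γ k + 1))
  have h9 := mul_le_mul_of_nonneg_left h6 (sub_nonneg.2 hα)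
  nlinarith

/-! ### Weak duality -/

theorem traceInner_Cmat (hε : 0 < ε) (hx : ∀ m, ε ≤ 1 + x m) (hβ : ∀ k, 0 ≤ β k)
    (V : Matrix (Fin M) (Fin M) ℂ) : traceInner (N.Cmat x β) V
      = ∑ m, (1 + x m) * (V m m).re + ∑ k, β k * quad V (N.h k)
        + ∑ m, N.lamDiag x β m * (V m m).re := by
  have h1 : (1 : Matrix (Fin M) (Fin M) ℂ) = Matrix.diagonal fun _ => ((1 : ℝ) : ℂ) := by simp
  rw [Cmat_eq hε hx hβ, baseMat, h1]
  simp only [traceInner_add_left, traceInner_sum_left, traceInner_smul_left,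
    traceInner_vecMulVec_left, traceInner_diagonal_left, ← Finset.sum_add_distrib, add_mul]

/-- The second expansion of tr(C V), through the rank-one matrices. Equating it with
`traceInner_Cmat` eliminates the fronthaul multipliers from the Lagrangian. -/
theorem traceInner_Cmat_eq_sum_lamVec (hε : 0 < ε) (hx : ∀ m, ε ≤ 1 + x m) (hβ : ∀ k, 0 ≤ β k)
    (V : Matrix (Fin M) (Fin M) ℂ) : traceInner (N.Cmat x β) V
      = ∑ m, N.lamDiag x β m * ((2 : ℝ) ^ N.cap m * quad V (N.lamVec x β m)) := by
  rw [sum_Lam hε hx hβ, traceInner_sum_left]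
  refine Finset.sum_congr rfl fun m _ => ?_
  rw [traceInner_smul_left, Lam_eq hε hx hβ, traceInner_smul_left, traceInner_vecMulVec_left]
  ring

/-- The Lagrangian in which the multipliers are eliminated by `C(β, x)`. -/
theorem lagrangian_identity (hε : 0 < ε) (hx : ∀ m, ε ≤ 1 + x m) (hβ : ∀ k, 0 ≤ β k)
    (V : Fin K → Matrix (Fin M) (Fin M) ℂ) (Q : Matrix (Fin M) (Fin M) ℂ) :
    ∑ m, (1 + x m) * power V Q m
      + ∑ j, β j * (∑ k, quad (V k) (N.h j) + quad Q (N.h j))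
      + ∑ m, N.lamDiag x β m * power V Q m
      = ∑ k, traceInner (N.Cmat x β) (V k) + traceInner (N.Cmat x β) Q := by
  have h1 := traceInner_Cmat (N := N) hε hx hβ (∑ k, V k)
  rw [traceInner_sum_right] at h1
  rw [h1, traceInner_Cmat hε hx hβ]
  have h2 : ∀ m, ((∑ k, V k) m m).re = ∑ k, (V k m m).re := fun m => by
    rw [Matrix.sum_apply, Complex.re_sum]
  simp only [power, mul_add, Finset.sum_add_distrib, h2, quad_sum]
  ring

theorem sinrLHS_eq (V : Fin K → Matrix (Fin M) (Fin M) ℂ) (Q : Matrix (Fin M) (Fin M) ℂ)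
    (k : Fin K) : N.sinrLHS V Q k = (1 + (N.γ k)⁻¹) * quad (V k) (N.h k)
      - (∑ j, quad (V j) (N.h k) + quad Q (N.h k)) := by
  rw [sinrLHS, ← quad.eq_1, quad_sub, quad_sub, quad_smul, quad_sum]
  ring

theorem quad_block {m : Fin M} {w : Fin M → ℂ} (hw : ∀ i, i < m → w i = 0)
    (Q : Matrix (Fin M) (Fin M) ℂ) :
    quad (Matrix.of fun i j => if m ≤ i ∧ m ≤ j then Q i j else 0) w = quad Q w := by
  simp only [quad, dotProduct, mulVec, Matrix.of_apply, Pi.star_apply]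
  congr 1
  refine Finset.sum_congr rfl fun i _ => ?_
  by_cases hi : m ≤ i
  · congr 1
    refine Finset.sum_congr rfl fun j _ => ?_
    by_cases hj : m ≤ j
    · simp [hi, hj]
    · simp [hw j (not_le.1 hj)]
  · simp [hw i (not_le.1 hi)]

/-- Up to the factor Λ_mm this is the pairing of the m-th fronthaul constraint with its multiplier
Λ_m. -/
theorem quad_fronthaulLHS_lamVec (V : Fin K → Matrix (Fin M) (Fin M) ℂ)
    (Q : Matrix (Fin M) (Fin M) ℂ) (m : Fin M) :
    quad (N.fronthaulLHS V Q m) (N.lamVec x β m)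
      = quad Q (N.lamVec x β m) - power V Q m / (2 : ℝ) ^ N.cap m := by
  rw [fronthaulLHS, quad_sub, quad_block fun i hi => lamVec_apply_of_lt hi, quad_single,
    lamVec_apply_self]
  simp only [Complex.ofReal_re, norm_one, one_pow, mul_one]

/-- Weak duality: subsolutions of `β = I_x(β)` are dual feasible. -/
theorem weak_duality (hN : N.StrictlyFeasible) (hε : 0 < ε) (hx : ∀ m, ε ≤ 1 + x m)
    (hβ : ∀ k, 0 ≤ β k) (hle : ∀ k, β k ≤ N.Imap x β k)
    {V : Fin K → Matrix (Fin M) (Fin M) ℂ} {Q : Matrix (Fin M) (Fin M) ℂ}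
    (hVQ : N.SubFeasible V Q) : ∑ k, β k * N.σsq k ≤ ∑ m, (1 + x m) * power V Q m := by
  obtain ⟨hV, hQ, hS, hF⟩ := hVQ
  have hC := posDef_Cmat (N := N) hε hx hβ
  have h1 := lagrangian_identity (N := N) hε hx hβ V Q
  have h2 : ∑ m, N.lamDiag x β m * power V Q m ≤ traceInner (N.Cmat x β) Q := by
    rw [traceInner_Cmat_eq_sum_lamVec hε hx hβ]
    refine Finset.sum_le_sum fun m _ => ?_
    refine mul_le_mul_of_nonneg_left ?_ (lamDiag_pos hε hx hβ m).le
    have h3 := (hF m).quad_nonneg (N.lamVec x β m)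
    rw [quad_fronthaulLHS_lamVec, sub_nonneg, div_le_iff₀ (by positivity)] at h3
    linarith
  -- The inequality β_k ≤ I_x(β)_k says exactly β_k (1 + 1/γ_k) ≤ 1/(h_k†C⁻¹h_k), that is, β_k (1 +
  -- 1/γ_k) h_k h_k† ≼ C.
  have h3 : ∀ k, β k * ((1 + (N.γ k)⁻¹) * quad (V k) (N.h k))
      ≤ traceInner (N.Cmat x β) (V k) := fun k => by
    rw [← mul_assoc, ← traceInner_vecMulVec_left, ← traceInner_smul_left]
    refine traceInner_mono (hV k) fun w => ?_
    rw [quad_smul, quad_vecMulVec]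
    refine le_trans ?_ (norm_sq_mul_inv_le hC (h_ne_zero hN k) w)
    rw [mul_comm]
    refine mul_le_mul_of_nonneg_left ?_ (by positivity)
    have hγ := N.γ_pos k
    have h4 := mul_le_mul_of_nonneg_right (hle k) (by positivity : 0 ≤ 1 + (N.γ k)⁻¹)
    refine h4.trans (le_of_eq ?_)
    rw [Imap_apply]
    field_simp
  have h4 := Finset.sum_le_sum fun k (_ : k ∈ Finset.univ) => h3 k
  have h5 := Finset.sum_le_sum fun k (_ : k ∈ Finset.univ) =>
    mul_le_mul_of_nonneg_left (hS k) (hβ k)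
  simp only [sinrLHS_eq, mul_sub, Finset.sum_sub_distrib] at h5
  linarith

end Network

namespace Network

open Matrix

variable {M K : ℕ} {N : Network M K}

variable {β p : EuclideanSpace ℝ (Fin K)} {x : EuclideanSpace ℝ (Fin M)} {ε : ℝ}

/-! ### The compression covariance -/

variable (N β x) in
/-- The congruence used in one back-substitution step. -/
def backMat (m : Fin M) : Matrix (Fin M) (Fin M) ℂ :=
  1 - vecMulVec (N.tailVec β x m) (Pi.single m 1)

theorem backMat_mulVec (m : Fin M) (w : Fin M → ℂ) :
    N.backMat β x m *ᵥ w = w - w m • N.tailVec β x m := by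
  rw [backMat, sub_mulVec, one_mulVec, vecMulVec_mulVec]
  simp

theorem backStep_eq (m : Fin M) (R : Matrix (Fin M) (Fin M) ℂ) : N.backStep β p x m R
    = (N.backMat β x m)ᴴ * R * N.backMat β x m + Matrix.single m m
      (((N.beamPower β p x m : ℝ) + star (N.tailVec β x m) ⬝ᵥ R *ᵥ N.tailVec β x m)
        / (((2 : ℝ) ^ N.cap m - 1 : ℝ) : ℂ)) := rfl

theorem quad_backStep (m : Fin M) (R : Matrix (Fin M) (Fin M) ℂ) (w : Fin M → ℂ) :
    quad (N.backStep β p x m R) w = quad R (w - w m • N.tailVec β x m)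
      + (N.beamPower β p x m + quad R (N.tailVec β x m)) / ((2 : ℝ) ^ N.cap m - 1) * ‖w m‖ ^ 2 := by
  rw [backStep_eq, quad_add, quad_conjTranspose_mul_mul, backMat_mulVec, quad_single,
    Complex.div_ofReal_re, Complex.add_re, Complex.ofReal_re, quad, quad]

theorem posSemidef_single {m : Fin M} {a : ℝ} (ha : 0 ≤ a) :
    (Matrix.single m m (a : ℂ)).PosSemidef := by
  refine IsHermitian.posSemidef_of_quad ?_ fun w => ?_
  · rw [IsHermitian, conjTranspose_single]
    congr 1
    exact Complex.conj_ofReal _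
  · rw [quad_single, Complex.ofReal_re]; positivity

theorem beamPower_nonneg (hp : ∀ k, 0 ≤ p k) (m : Fin M) : 0 ≤ N.beamPower β p x m :=
  Finset.sum_nonneg fun k _ => mul_nonneg (hp k) (by positivity)

theorem posSemidef_backStep (hp : ∀ k, 0 ≤ p k) (m : Fin M) {R : Matrix (Fin M) (Fin M) ℂ}
    (hR : R.PosSemidef) : (N.backStep β p x m R).PosSemidef := by
  have h := N.two_rpow_cap_sub_one_pos m
  rw [backStep_eq, ← hR.isHermitian.ofReal_quad, ← Complex.ofReal_add, ← Complex.ofReal_div]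
  refine (hR.conjTranspose_mul_mul_same _).add (posSemidef_single ?_)
  have := beamPower_nonneg (N := N) (β := β) (x := x) hp m
  have := hR.quad_nonneg (N.tailVec β x m)
  positivity

theorem backMat_apply_of_ne {m j : Fin M} (hj : j ≠ m) (k : Fin M) :
    N.backMat β x m k j = (1 : Matrix (Fin M) (Fin M) ℂ) k j := by
  simp [backMat, vecMulVec_apply, hj]

theorem backStep_apply_row {m : Fin M} (R : Matrix (Fin M) (Fin M) ℂ) {i : Fin M} (hi : i ≠ m)
    (j : Fin M) : N.backStep β p x m R i j = ∑ l, R i l * N.backMat β x m l j := by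
  rw [backStep_eq, Matrix.add_apply, single_apply_of_row_ne hi.symm, add_zero]
  simp only [Matrix.mul_apply, conjTranspose_apply, backMat_apply_of_ne hi]
  simp [Matrix.one_apply]

theorem backStep_apply_col {m : Fin M} (R : Matrix (Fin M) (Fin M) ℂ) (i : Fin M) {j : Fin M}
    (hj : j ≠ m) : N.backStep β p x m R i j = ∑ k, star (N.backMat β x m k i) * R k j := by
  rw [backStep_eq, Matrix.add_apply, single_apply_of_col_ne _ _ hj.symm, add_zero]
  simp only [Matrix.mul_apply, conjTranspose_apply, backMat_apply_of_ne hj]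
  simp [Matrix.one_apply]

theorem backStep_apply {m : Fin M} (R : Matrix (Fin M) (Fin M) ℂ) {i j : Fin M} (hi : i ≠ m)
    (hj : j ≠ m) : N.backStep β p x m R i j = R i j := by
  rw [backStep_apply_row R hi]
  simp only [backMat_apply_of_ne hj]
  simp [Matrix.one_apply]

variable (N β p x) in
/-- The partial back substitution, down to the index `n`. -/
def qTail (n : ℕ) : Matrix (Fin M) (Fin M) ℂ :=
  ((List.finRange M).drop n).foldr (fun m R => N.backStep β p x m R) 0

theorem qTail_of_lt {n : ℕ} (hn : n < M) :
    N.qTail β p x n = N.backStep β p x ⟨n, hn⟩ (N.qTail β p x (n + 1)) := by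
  rw [qTail, List.drop_eq_getElem_cons (by simpa using hn), List.foldr_cons, List.getElem_finRange]
  rfl

theorem qTail_of_le {n : ℕ} (hn : M ≤ n) : N.qTail β p x n = 0 := by
  rw [qTail, List.drop_eq_nil_of_le (by simpa using hn), List.foldr_nil]

theorem posSemidef_qTail (hp : ∀ k, 0 ≤ p k) (n : ℕ) : (N.qTail β p x n).PosSemidef := by
  rw [qTail]
  induction (List.finRange M).drop n with
  | nil => exact PosSemidef.zero
  | cons m l ih => exact posSemidef_backStep hp m ih

theorem posSemidef_Qmat (hp : ∀ k, 0 ≤ p k) : (N.Qmat β p x).PosSemidef := posSemidef_qTail hp 0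

/-- Each back-substitution step combines the previous form and the beamforming power with
nonnegative weights that do not depend on p, so scaled inequalities propagate. -/
theorem quad_Qmat_le {p' : EuclideanSpace ℝ (Fin K)} {α : ℝ} (h : ∀ k, p k ≤ α * p' k)
    (w : Fin M → ℂ) : quad (N.Qmat β p x) w ≤ α * quad (N.Qmat β p' x) w := by
  rw [Qmat, Qmat]
  induction List.finRange M generalizing w with
  | nil => simp [quad_zero]
  | cons m l ih =>
    simp only [List.foldr_cons, quad_backStep]
    have h1 := ih (w - w m • N.tailVec β x m)
    have h2 := ih (N.tailVec β x m)
    have h3 : N.beamPower β p x m ≤ α * N.beamPower β p' x m := by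
      rw [beamPower, beamPower, Finset.mul_sum]
      refine Finset.sum_le_sum fun k _ => ?_
      rw [← mul_assoc]
      exact mul_le_mul_of_nonneg_right (h k) (by positivity)
    have hc := N.two_rpow_cap_sub_one_pos m
    have h4 := mul_le_mul_of_nonneg_right (add_le_add h3 h2)
      (by positivity : 0 ≤ ((2 : ℝ) ^ N.cap m - 1)⁻¹ * ‖w m‖ ^ 2)
    simp only [div_eq_mul_inv]
    linarith

theorem qTail_apply_eq_zero {n : ℕ} {i j : Fin M} (h : (i : ℕ) < n ∨ (j : ℕ) < n) :
    N.qTail β p x n i j = 0 := by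
  obtain ⟨d, hd⟩ : ∃ d, M - n = d := ⟨_, rfl⟩
  induction d generalizing n i j with
  | zero => rw [qTail_of_le (Nat.sub_eq_zero_iff_le.1 hd)]; rfl
  | succ d ih =>
    have hn : n < M := by omega
    rw [qTail_of_lt hn]
    rcases h with h | h
    · have hi : i ≠ ⟨n, hn⟩ := by rintro rfl; simp at h
      rw [backStep_apply_row _ hi, Finset.sum_eq_zero]
      intro l _
      rw [ih (Or.inl (h.trans (Nat.lt_succ_self n))) (by omega), zero_mul]
    · have hj : j ≠ ⟨n, hn⟩ := by rintro rfl; simp at h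
      rw [backStep_apply_col _ _ hj, Finset.sum_eq_zero]
      intro l _
      rw [ih (Or.inr (h.trans (Nat.lt_succ_self n))) (by omega), mul_zero]

/-- A step at m writes only into row and column m, so the entries computed earlier remain. -/
theorem Qmat_apply {n : ℕ} {i j : Fin M} (hi : n ≤ i) (hj : n ≤ j) :
    N.Qmat β p x i j = N.qTail β p x n i j := by
  induction n with
  | zero => rfl
  | succ n ih =>
    have hn : n < M := by omega
    rw [ih (by omega) (by omega), qTail_of_lt hn, backStep_apply]
    · rintro rfl; simp at hi
    · rintro rfl; simp at hj

theorem quad_congr {R : Matrix (Fin M) (Fin M) ℂ} {n : ℕ}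
    (hR : ∀ i j : Fin M, (i : ℕ) < n ∨ (j : ℕ) < n → R i j = 0) {w w' : Fin M → ℂ}
    (h : ∀ i : Fin M, n ≤ i → w i = w' i) : quad R w = quad R w' := by
  simp only [quad, dotProduct, mulVec, Pi.star_apply]
  congr 1
  refine Finset.sum_congr rfl fun i _ => ?_
  rcases lt_or_ge (i : ℕ) n with hi | hi
  · simp [hR i _ (Or.inl hi)]
  · rw [h i hi]
    congr 1
    refine Finset.sum_congr rfl fun j _ => ?_
    rcases lt_or_ge (j : ℕ) n with hj | hj
    · simp [hR i j (Or.inr hj)]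
    · rw [h j hj]

theorem Qmat_diag_re (m : Fin M) : (N.Qmat β p x m m).re
    = quad (N.qTail β p x (m + 1)) (N.tailVec β x m) + (N.beamPower β p x m
      + quad (N.qTail β p x (m + 1)) (N.tailVec β x m)) / ((2 : ℝ) ^ N.cap m - 1) := by
  rw [Qmat_apply (n := m) le_rfl le_rfl, ← quad_piSingle, qTail_of_lt m.2, quad_backStep]
  -- The vector e_m − t agrees with −t after m, and the tail form sees only those indices.
  have h : quad (N.qTail β p x (m + 1)) (Pi.single m 1 - (Pi.single m (1 : ℂ) : Fin M → ℂ) m •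
      N.tailVec β x m) = quad (N.qTail β p x (m + 1)) (N.tailVec β x m) := by
    rw [← quad_neg_right]
    refine quad_congr (fun i j hij => qTail_apply_eq_zero hij) fun i hi => ?_
    have : i ≠ m := by rintro rfl; simp at hi
    simp [this]
  rw [Fin.eta, h]
  simp

variable (N β p x) in
/-- The beamforming covariances `p_k u_k u_k†`. -/
def beamCov (k : Fin K) : Matrix (Fin M) (Fin M) ℂ :=
  (p k : ℂ) • vecMulVec (N.beam β x k) (star (N.beam β x k))

theorem power_beamCov (m : Fin M) : power (N.beamCov β p x) (N.Qmat β p x) m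
    = N.beamPower β p x m + (N.Qmat β p x m m).re := by
  rw [power, beamPower]
  congr 1
  refine Finset.sum_congr rfl fun k _ => ?_
  rw [beamCov, Matrix.smul_apply, vecMulVec_apply, smul_eq_mul, Complex.re_ofReal_mul,
    ← Complex.normSq_eq_norm_sq, Pi.star_apply]
  congr 1
  rw [Complex.star_def, Complex.mul_conj, Complex.ofReal_re]

/-- This explains the diagonal term of `backStep`. With s the beamforming power and a = t†Rt, Q_mm =
a + (s + a)/(2^cap_m − 1) solves Q_mm − 2^(−cap_m) (s + Q_mm) = a. -/
theorem power_div (m : Fin M) : power (N.beamCov β p x) (N.Qmat β p x) m / (2 : ℝ) ^ N.cap m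
    = (N.beamPower β p x m + quad (N.qTail β p x (m + 1)) (N.tailVec β x m))
      / ((2 : ℝ) ^ N.cap m - 1) := by
  have h := N.two_rpow_cap_sub_one_pos m
  have h2 : (0 : ℝ) < 2 ^ N.cap m := by positivity
  rw [power_beamCov, Qmat_diag_re]
  field_simp
  ring

/-- Back substitution makes the slack of the fronthaul constraint a congruence transform of the
part of `Q` after the index `m`. -/
theorem fronthaulLHS_eq (hp : ∀ k, 0 ≤ p k) (m : Fin M) :
    N.fronthaulLHS (N.beamCov β p x) (N.Qmat β p x) m
      = (N.backMat β x m)ᴴ * N.qTail β p x (m + 1) * N.backMat β x m := by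
  have h1 : (Matrix.of fun i j => if m ≤ i ∧ m ≤ j then N.Qmat β p x i j else 0)
      = N.qTail β p x m := by
    ext i j
    rw [Matrix.of_apply]
    split_ifs with h
    · exact Qmat_apply h.1 h.2
    · refine (qTail_apply_eq_zero ?_).symm
      rw [not_and_or, not_le, not_le] at h
      exact h
  rw [fronthaulLHS, h1, qTail_of_lt m.2, backStep_eq, power_div,
    ← (posSemidef_qTail hp _).isHermitian.ofReal_quad, ← Complex.ofReal_add, ← Complex.ofReal_div]
  exact add_sub_cancel_right _ _

theorem posSemidef_fronthaulLHS (hp : ∀ k, 0 ≤ p k) (m : Fin M) :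
    (N.fronthaulLHS (N.beamCov β p x) (N.Qmat β p x) m).PosSemidef := by
  rw [fronthaulLHS_eq hp]
  exact (posSemidef_qTail hp _).conjTranspose_mul_mul_same _

/-- The congruence `backMat` sends the vector of Λ_m to e_m, which the tail of Q after m
annihilates. The fronthaul constraint is therefore tight in the direction of its multiplier. -/
theorem two_rpow_mul_quad_lamVec (hp : ∀ k, 0 ≤ p k) (m : Fin M) :
    (2 : ℝ) ^ N.cap m * quad (N.Qmat β p x) (N.lamVec x β m)
      = power (N.beamCov β p x) (N.Qmat β p x) m := by
  have h1 := quad_fronthaulLHS_lamVec (N := N) (x := x) (β := β) (N.beamCov β p x) (N.Qmat β p x) m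
  rw [fronthaulLHS_eq hp, quad_conjTranspose_mul_mul, backMat_mulVec, lamVec_apply_self, one_smul,
    lamVec, add_sub_cancel_right, quad_piSingle,
    qTail_apply_eq_zero (Or.inl (Nat.lt_succ_self _)), Complex.zero_re] at h1
  have h2 : (2 : ℝ) ^ N.cap m ≠ 0 := by positivity
  rw [eq_comm, sub_eq_zero] at h1
  rw [lamVec, h1]
  field_simp

/-- Complementary slackness for the fronthaul constraints. -/
theorem traceInner_Cmat_Qmat (hε : 0 < ε) (hx : ∀ m, ε ≤ 1 + x m) (hβ : ∀ k, 0 ≤ β k)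
    (hp : ∀ k, 0 ≤ p k) : traceInner (N.Cmat x β) (N.Qmat β p x)
      = ∑ m, N.lamDiag x β m * power (N.beamCov β p x) (N.Qmat β p x) m := by
  rw [traceInner_Cmat_eq_sum_lamVec hε hx hβ]
  simp only [two_rpow_mul_quad_lamVec hp]

/-! ### The beamforming directions and the mapping `J_{β,x}` -/

theorem inv_mulVec_ne_zero {C : Matrix (Fin M) (Fin M) ℂ} (hC : C.PosDef) {h : Fin M → ℂ}
    (hh : h ≠ 0) : C⁻¹ *ᵥ h ≠ 0 := by
  intro h0
  have := mulVec_inv_mulVec hC h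
  rw [h0, mulVec_zero] at this
  exact hh this.symm

theorem norm_toLp_pos {w : Fin M → ℂ} (hw : w ≠ 0) : 0 < ‖WithLp.toLp 2 w‖ := by
  rw [norm_pos_iff]
  intro h
  exact hw (by simpa using h)

theorem sum_norm_sq_eq (w : Fin M → ℂ) : ∑ m, ‖w m‖ ^ 2 = ‖WithLp.toLp 2 w‖ ^ 2 := by
  rw [EuclideanSpace.norm_sq_eq]

theorem sum_norm_beam_sq {k : Fin K} (hC : (N.Cmat x β).PosDef) (hh : N.h k ≠ 0) :
    ∑ m, ‖N.beam β x k m‖ ^ 2 = 1 := by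
  have h := norm_toLp_pos (inv_mulVec_ne_zero hC hh)
  simp only [beam, Pi.smul_apply, smul_eq_mul, norm_mul, mul_pow, ← Finset.mul_sum, sum_norm_sq_eq,
    Complex.norm_real, norm_inv, norm_norm]
  field_simp

theorem norm_dotProduct_beam {k : Fin K} (hC : (N.Cmat x β).PosDef) (hh : N.h k ≠ 0) :
    ‖star (N.h k) ⬝ᵥ N.beam β x k‖
      = ‖WithLp.toLp 2 ((N.Cmat x β)⁻¹ *ᵥ N.h k)‖⁻¹ * quad (N.Cmat x β)⁻¹ (N.h k) := by
  rw [beam, dotProduct_smul, dotProduct_inv_mulVec hC, smul_eq_mul, norm_mul, Complex.norm_real,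
    Complex.norm_real, norm_inv, norm_norm, Real.norm_of_nonneg (quad_inv_pos hC hh).le]

theorem norm_dotProduct_beam_pos {k : Fin K} (hC : (N.Cmat x β).PosDef) (hh : N.h k ≠ 0) :
    0 < ‖star (N.h k) ⬝ᵥ N.beam β x k‖ := by
  rw [norm_dotProduct_beam hC hh]
  exact mul_pos (inv_pos.2 (norm_toLp_pos (inv_mulVec_ne_zero hC hh))) (quad_inv_pos hC hh)

/-- The equality case of `norm_sq_mul_inv_le`: u_k is parallel to C⁻¹h_k. -/
theorem quad_Cmat_beam {k : Fin K} (hC : (N.Cmat x β).PosDef) (hh : N.h k ≠ 0) :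
    quad (N.Cmat x β) (N.beam β x k)
      = ‖star (N.h k) ⬝ᵥ N.beam β x k‖ ^ 2 * (1 / quad (N.Cmat x β)⁻¹ (N.h k)) := by
  have hq := quad_inv_pos hC hh
  have h1 : ∀ (a : ℝ) (w : Fin M → ℂ), quad (N.Cmat x β) ((a : ℂ) • w)
      = a ^ 2 * quad (N.Cmat x β) w := fun a w => by
    simp only [quad, star_smul, mulVec_smul, smul_dotProduct, dotProduct_smul, smul_eq_mul,
      Complex.star_def, Complex.conj_ofReal, Complex.re_ofReal_mul]
    ring
  rw [norm_dotProduct_beam hC hh, beam, h1, quad_inv_mulVec hC]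
  field_simp

theorem Jmap_apply (k : Fin K) : N.Jmap β x p k
    = N.γ k * ((∑ j ∈ Finset.univ.erase k, p j * ‖star (N.h k) ⬝ᵥ N.beam β x j‖ ^ 2)
        + quad (N.Qmat β p x) (N.h k) + N.σsq k)
      / ‖star (N.h k) ⬝ᵥ N.beam β x k‖ ^ 2 := rfl

/-- Interference scales with p while the noise term does not. As u_k is a unit vector, the noise
term is at least γ_k σ_k² / ‖h_k‖², which gives a constant independent of β and x. -/
theorem Jmap_isInterference (hN : N.StrictlyFeasible) (hε : 0 < ε) :
    ∃ c, 0 < c ∧ ∀ (x : EuclideanSpace ℝ (Fin M)) (β : EuclideanSpace ℝ (Fin K)),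
      (∀ m, ε ≤ 1 + x m) → (∀ k, 0 ≤ β k) → IsInterference (N.Jmap β x) c := by
  obtain ⟨c, hc, hck⟩ := exists_pos_forall_le
    (f := fun k => N.γ k * N.σsq k / ∑ m, ‖N.h k m‖ ^ 2) fun k => by
      have := N.γ_pos k
      have := N.σsq_pos k
      have := sum_norm_sq_pos (h_ne_zero hN k)
      positivity
  refine ⟨c, hc, fun x β hx hβ p q α hp hq hα hle k => ?_⟩
  have hC := posDef_Cmat (N := N) hε hx hβ
  have hh := h_ne_zero hN k
  have hγ := N.γ_pos k
  have hσ := N.σsq_pos k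
  have hu := norm_dotProduct_beam_pos hC hh
  have h1 := quad_Qmat_le (N := N) (β := β) (x := x) hle (N.h k)
  have h2 : ∑ j ∈ Finset.univ.erase k, p j * ‖star (N.h k) ⬝ᵥ N.beam β x j‖ ^ 2
      ≤ α * ∑ j ∈ Finset.univ.erase k, q j * ‖star (N.h k) ⬝ᵥ N.beam β x j‖ ^ 2 := by
    rw [Finset.mul_sum]
    refine Finset.sum_le_sum fun j _ => ?_
    rw [← mul_assoc]
    exact mul_le_mul_of_nonneg_right (hle j) (by positivity)
  have h3 : ‖star (N.h k) ⬝ᵥ N.beam β x k‖ ^ 2 ≤ ∑ m, ‖N.h k m‖ ^ 2 := by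
    have := norm_dotProduct_sq_le (N.h k) (N.beam β x k)
    rwa [sum_norm_beam_sq hC hh, mul_one] at this
  have h4 : c ≤ N.γ k * N.σsq k / ‖star (N.h k) ⬝ᵥ N.beam β x k‖ ^ 2 :=
    (hck k).trans (by gcongr)
  have h5 := mul_le_mul_of_nonneg_left h4 (sub_nonneg.2 hα)
  have h6 := mul_le_mul_of_nonneg_right (add_le_add h2 h1)
    (by positivity : 0 ≤ N.γ k * (‖star (N.h k) ⬝ᵥ N.beam β x k‖ ^ 2)⁻¹)
  simp only [Jmap_apply, div_eq_mul_inv] at *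
  linarith

/-! ### The primal solution -/

theorem quad_beamCov (k : Fin K) (w : Fin M → ℂ) :
    quad (N.beamCov β p x k) w = p k * ‖star w ⬝ᵥ N.beam β x k‖ ^ 2 := by
  rw [beamCov, quad_smul, quad_vecMulVec, norm_star_dotProduct_comm]

theorem posSemidef_beamCov (hp : ∀ k, 0 ≤ p k) (k : Fin K) : (N.beamCov β p x k).PosSemidef := by
  refine IsHermitian.posSemidef_of_quad ?_ fun w => ?_
  · rw [beamCov, IsHermitian, conjTranspose_smul, conjTranspose_vecMulVec, star_star]
    congr 1
    exact Complex.conj_ofReal _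
  · rw [quad_beamCov]
    exact mul_nonneg (hp k) (by positivity)

/-- The slack of the SINR constraint has the sign of p_k − J(p)_k: fixed points make it tight,
subsolutions leave it at or below σ_k². -/
theorem sinrLHS_beamCov {k : Fin K} (hu : 0 < ‖star (N.h k) ⬝ᵥ N.beam β x k‖) :
    N.sinrLHS (N.beamCov β p x) (N.Qmat β p x) k = N.σsq k
      + ‖star (N.h k) ⬝ᵥ N.beam β x k‖ ^ 2 / N.γ k * (p k - N.Jmap β x p k) := by
  have hγ := N.γ_pos k
  rw [sinrLHS_eq, Jmap_apply]
  simp only [quad_beamCov]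
  rw [← Finset.add_sum_erase Finset.univ _ (Finset.mem_univ k)]
  field_simp
  ring

/-- At the fixed point of `I_x` the cost of the beamforming solution is given by the SINR terms. -/
theorem cost_beamCov (hN : N.StrictlyFeasible) (hε : 0 < ε) (hx : ∀ m, ε ≤ 1 + x m)
    (hβ : ∀ k, 0 ≤ β k) (hfix : N.Imap x β = β) (hp : ∀ k, 0 ≤ p k) :
    ∑ m, (1 + x m) * power (N.beamCov β p x) (N.Qmat β p x) m
      = ∑ k, β k * N.sinrLHS (N.beamCov β p x) (N.Qmat β p x) k := by
  have hC := posDef_Cmat (N := N) hε hx hβ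
  have h1 := lagrangian_identity (N := N) hε hx hβ (N.beamCov β p x) (N.Qmat β p x)
  rw [traceInner_Cmat_Qmat hε hx hβ hp] at h1
  have h2 : ∀ k, traceInner (N.Cmat x β) (N.beamCov β p x k)
      = β k * ((1 + (N.γ k)⁻¹) * quad (N.beamCov β p x k) (N.h k)) := fun k => by
    have hh := h_ne_zero hN k
    have hγ := N.γ_pos k
    have hq := quad_inv_pos hC hh
    have h3 : β k = N.γ k / (N.γ k + 1) * (1 / quad (N.Cmat x β)⁻¹ (N.h k)) := by
      rw [← Imap_apply, hfix]
    -- The fixed-point equation turns the domination used in weak duality into an equality along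
    -- u_k.
    have h4 : 1 / quad (N.Cmat x β)⁻¹ (N.h k) = β k * (1 + (N.γ k)⁻¹) := by
      rw [h3]; field_simp
    have h5 : traceInner (N.Cmat x β) (N.beamCov β p x k)
        = p k * quad (N.Cmat x β) (N.beam β x k) := by
      rw [← traceInner_vecMulVec_right, beamCov, traceInner, traceInner]
      simp
    rw [h5, quad_Cmat_beam hC hh, quad_beamCov, h4]
    ring
  simp only [h2] at h1
  simp only [sinrLHS_eq, mul_sub, Finset.sum_sub_distrib]
  linarith

theorem subFeasible_beamCov (hN : N.StrictlyFeasible) (hε : 0 < ε) (hx : ∀ m, ε ≤ 1 + x m)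
    (hβ : ∀ k, 0 ≤ β k) (hp : ∀ k, 0 ≤ p k) (hfix : N.Jmap β x p = p) :
    N.SubFeasible (N.beamCov β p x) (N.Qmat β p x) := by
  refine ⟨posSemidef_beamCov hp, posSemidef_Qmat hp, fun k => ?_, posSemidef_fronthaulLHS hp⟩
  rw [sinrLHS_beamCov (norm_dotProduct_beam_pos (posDef_Cmat hε hx hβ) (h_ne_zero hN k)), hfix]
  simp

/-- As the u_k are unit vectors, Σ p_k is the total beamforming power; Q only adds to the cost. -/
theorem cost_nonneg_bound (hN : N.StrictlyFeasible) (hε : 0 < ε) (hx : ∀ m, ε ≤ 1 + x m)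
    (hβ : ∀ k, 0 ≤ β k) (hp : ∀ k, 0 ≤ p k) :
    ε * ∑ k, p k ≤ ∑ m, (1 + x m) * power (N.beamCov β p x) (N.Qmat β p x) m := by
  have hC := posDef_Cmat (N := N) hε hx hβ
  have h1 : ∑ k, p k = ∑ m, N.beamPower β p x m := by
    simp only [beamPower]
    rw [Finset.sum_comm]
    refine Finset.sum_congr rfl fun k _ => ?_
    rw [← Finset.mul_sum, sum_norm_beam_sq hC (h_ne_zero hN k), mul_one]
  rw [h1, Finset.mul_sum]
  refine Finset.sum_le_sum fun m _ => ?_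
  have h2 := beamPower_nonneg (N := N) (β := β) (x := x) hp m
  have h3 : 0 ≤ (N.Qmat β p x m m).re := by
    rw [← quad_piSingle]; exact (posSemidef_Qmat hp).quad_nonneg _
  rw [power_beamCov]
  exact mul_le_mul (hx m) (by linarith) h2 (hε.le.trans (hx m))

/-- A subsolution has SINR values at most σ_k², so at the fixed point of I_x its cost is at most Σ
β_k σ_k², and the cost controls p. This gives the fixed point p⋆(x). -/
theorem le_of_le_Jmap (hN : N.StrictlyFeasible) (hε : 0 < ε) (hx : ∀ m, ε ≤ 1 + x m)
    (hβ : ∀ k, 0 ≤ β k) (hfix : N.Imap x β = β) (hp : ∀ k, 0 ≤ p k)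
    (hle : ∀ k, p k ≤ N.Jmap β x p k) (k : Fin K) : p k ≤ (∑ k, β k * N.σsq k) / ε := by
  rw [le_div_iff₀ hε]
  have h1 := cost_nonneg_bound hN hε hx hβ hp
  rw [cost_beamCov hN hε hx hβ hfix hp] at h1
  have h2 : ∑ k, β k * N.sinrLHS (N.beamCov β p x) (N.Qmat β p x) k ≤ ∑ k, β k * N.σsq k := by
    refine Finset.sum_le_sum fun k _ => mul_le_mul_of_nonneg_left ?_ (hβ k)
    have hu := norm_dotProduct_beam_pos (posDef_Cmat (N := N) hε hx hβ) (h_ne_zero hN k)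
    rw [sinrLHS_beamCov hu]
    have := N.γ_pos k
    have := mul_nonneg (by positivity : 0 ≤ ‖star (N.h k) ⬝ᵥ N.beam β x k‖ ^ 2 / N.γ k)
      (sub_nonneg.2 (hle k))
    linarith
  have h3 : p k ≤ ∑ k, p k :=
    Finset.single_le_sum (f := fun k => p k) (fun k _ => hp k) (Finset.mem_univ k)
  nlinarith

end Network

namespace Network

open Matrix

variable {M K : ℕ} {N : Network M K}

variable {x : EuclideanSpace ℝ (Fin M)} {ε : ℝ}

/-! ### Strong duality -/

theorem posSemidef_of_submatrix {A : Matrix (Fin M) (Fin M) ℂ} {m : Fin M}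
    (h0 : ∀ i j, ¬(m ≤ i ∧ m ≤ j) → A i j = 0)
    (h : (A.submatrix (Subtype.val : {i : Fin M // m ≤ i} → Fin M) Subtype.val).PosSemidef) :
    A.PosSemidef := by
  have hH : A.IsHermitian := by
    refine IsHermitian.ext fun i j => ?_
    by_cases hij : m ≤ i ∧ m ≤ j
    · exact h.isHermitian.apply ⟨i, hij.1⟩ ⟨j, hij.2⟩
    · rw [h0 i j hij, h0 j i fun h => hij h.symm, star_zero]
  refine hH.posSemidef_of_quad fun w => ?_
  have h1 := h.quad_nonneg fun i => w i
  have hsum : ∀ f : Fin M → ℂ, (∀ i, ¬m ≤ i → f i = 0) → ∑ i, f i = ∑ i : {i // m ≤ i}, f i := by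
    intro f hf
    rw [← Finset.sum_subtype (Finset.univ.filter fun i => m ≤ i) (by simp) f, Finset.sum_filter]
    refine Finset.sum_congr rfl fun i _ => ?_
    split_ifs with hi
    · rfl
    · exact hf i hi
  refine h1.trans (le_of_eq ?_)
  simp only [quad, dotProduct, mulVec, Pi.star_apply, Matrix.submatrix_apply]
  congr 1
  rw [hsum]
  · refine Finset.sum_congr rfl fun i _ => ?_
    congr 1
    rw [hsum]
    intro j hj
    rw [h0 _ _ fun h => hj h.2, zero_mul]
  · intro i hi
    rw [Finset.sum_eq_zero, mul_zero]
    intro j _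
    rw [h0 _ _ fun h => hi h.1, zero_mul]

theorem StrictlyFeasible.exists_subFeasible (hN : N.StrictlyFeasible) :
    ∃ (V : Fin K → Matrix (Fin M) (Fin M) ℂ) (Q : Matrix (Fin M) (Fin M) ℂ),
      N.SubFeasible V Q := by
  obtain ⟨V, Q, hV, hQ, hS, hF, -⟩ := hN
  refine ⟨V, Q, fun k => (hV k).posSemidef, hQ.posSemidef, fun k => (hS k).le, fun m => ?_⟩
  refine posSemidef_of_submatrix (m := m) (fun i j hij => ?_) (hF m).posSemidef
  rw [fronthaulLHS, Matrix.sub_apply, Matrix.of_apply, if_neg hij, Matrix.single_apply, if_neg,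
    sub_zero]
  rintro ⟨rfl, rfl⟩
  exact hij ⟨le_rfl, le_rfl⟩

theorem power_nonneg {V : Fin K → Matrix (Fin M) (Fin M) ℂ} {Q : Matrix (Fin M) (Fin M) ℂ}
    (h : N.SubFeasible V Q) (m : Fin M) : 0 ≤ power V Q m := by
  rw [power]
  have h1 : ∀ A : Matrix (Fin M) (Fin M) ℂ, A.PosSemidef → 0 ≤ (A m m).re := fun A hA => by
    rw [← quad_piSingle]; exact hA.quad_nonneg _
  exact add_nonneg (Finset.sum_nonneg fun k _ => h1 _ (h.1 k)) (h1 _ h.2.1)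

/-- Subsolutions of `β = I_x(β)` are bounded, uniformly for bounded `x`. -/
theorem exists_bound_of_le_Imap (hN : N.StrictlyFeasible) (hε : 0 < ε) (R : ℝ) :
    ∃ B, ∀ (x : EuclideanSpace ℝ (Fin M)) (β : EuclideanSpace ℝ (Fin K)), (∀ m, ε ≤ 1 + x m) →
      (∀ m, 1 + x m ≤ R) → (∀ k, 0 ≤ β k) → (∀ k, β k ≤ N.Imap x β k) →
      (∀ k, β k ≤ B) ∧ ∑ k, β k * N.σsq k ≤ B := by
  obtain ⟨V, Q, hVQ⟩ := hN.exists_subFeasible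
  obtain ⟨s, hs, hsk⟩ := exists_pos_forall_le N.σsq_pos
  -- Weak duality against one fixed feasible point bounds Σ β_k σ_k²; dividing by a lower bound s of
  -- the noise powers bounds each entry.
  refine ⟨max ((∑ m, R * power V Q m) / s) (∑ m, R * power V Q m), fun x β hx hR hβ hle => ?_⟩
  have h1 := weak_duality hN hε hx hβ hle hVQ
  have h2 : ∑ k, β k * N.σsq k ≤ ∑ m, R * power V Q m := h1.trans
    (Finset.sum_le_sum fun m _ => mul_le_mul_of_nonneg_right (hR m) (power_nonneg hVQ m))
  refine ⟨fun k => le_trans ?_ (le_max_left _ _), h2.trans (le_max_right _ _)⟩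
  rw [le_div_iff₀ hs]
  calc β k * s ≤ β k * N.σsq k := mul_le_mul_of_nonneg_left (hsk k) (hβ k)
    _ ≤ ∑ k, β k * N.σsq k := Finset.single_le_sum (f := fun k => β k * N.σsq k)
        (fun k _ => mul_nonneg (hβ k) (N.σsq_pos k).le) (Finset.mem_univ k)
    _ ≤ _ := h2

theorem betaStar_spec (hN : N.StrictlyFeasible) (hε : 0 < ε) (hx : ∀ m, ε ≤ 1 + x m) :
    (∀ k, 0 ≤ N.betaStar x k) ∧ N.Imap x (N.betaStar x) = N.betaStar x := by
  obtain ⟨c, hc, hI⟩ := Imap_isInterference hN hε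
  obtain ⟨B, hB⟩ := exists_bound_of_le_Imap hN hε (1 + ‖x‖)
  have hR : ∀ m, 1 + x m ≤ 1 + ‖x‖ := fun m => by
    have := (le_abs_self _).trans (EuclideanSpace.abs_apply_le_norm x m)
    linarith
  exact Classical.epsilon_spec (p := fun β : EuclideanSpace ℝ (Fin K) =>
    (∀ k, 0 ≤ β k) ∧ N.Imap x β = β) ((hI x hx).exists_fixedPoint hc.le
      fun β hβ hle => (hB x β hx hR hβ hle).1)

theorem pStar_spec_of_exists {β : EuclideanSpace ℝ (Fin K)}
    (h : ∃ p : EuclideanSpace ℝ (Fin K), (∀ k, 0 ≤ p k) ∧ N.Jmap β x p = p) :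
    (∀ k, 0 ≤ N.pStar β x k) ∧ N.Jmap β x (N.pStar β x) = N.pStar β x :=
  Classical.epsilon_spec (p := fun p : EuclideanSpace ℝ (Fin K) =>
    (∀ k, 0 ≤ p k) ∧ N.Jmap β x p = p) h

theorem pStar_betaStar_spec (hN : N.StrictlyFeasible) (hε : 0 < ε) (hx : ∀ m, ε ≤ 1 + x m) :
    (∀ k, 0 ≤ N.pStar (N.betaStar x) x k) ∧
      N.Jmap (N.betaStar x) x (N.pStar (N.betaStar x) x) = N.pStar (N.betaStar x) x := by
  obtain ⟨c, hc, hJ⟩ := Jmap_isInterference hN hε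
  obtain ⟨hβ, hfix⟩ := betaStar_spec hN hε hx
  exact pStar_spec_of_exists ((hJ x _ hx hβ).exists_fixedPoint hc.le
    fun p hp hle => le_of_le_Jmap hN hε hx hβ hfix hp hle)

theorem dualFun_le (hN : N.StrictlyFeasible) (hε : 0 < ε) (hx : ∀ m, ε ≤ 1 + x m)
    {V : Fin K → Matrix (Fin M) (Fin M) ℂ} {Q : Matrix (Fin M) (Fin M) ℂ}
    (hVQ : N.SubFeasible V Q) :
    N.dualFun x ≤ ∑ m, ((1 + x m) * power V Q m - x m * N.P m) := by
  obtain ⟨hβ, hfix⟩ := betaStar_spec hN hε hx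
  -- A real infimum is meaningful only for a set bounded below; weak duality at β⋆ supplies the
  -- bound.
  refine csInf_le ⟨N.dTilde (N.betaStar x) x, ?_⟩ ⟨V, Q, hVQ, rfl⟩
  rintro _ ⟨V, Q, hVQ, rfl⟩
  rw [Finset.sum_sub_distrib, dTilde]
  exact sub_le_sub_right (weak_duality hN hε hx hβ (fun k => by rw [hfix]) hVQ) _

theorem subFeasible_star (hN : N.StrictlyFeasible) (hε : 0 < ε) (hx : ∀ m, ε ≤ 1 + x m) :
    N.SubFeasible (N.beamCov (N.betaStar x) (N.pStar (N.betaStar x) x) x)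
      (N.Qmat (N.betaStar x) (N.pStar (N.betaStar x) x) x) := by
  obtain ⟨hβ, -⟩ := betaStar_spec hN hε hx
  obtain ⟨hp, hpfix⟩ := pStar_betaStar_spec hN hε hx
  exact subFeasible_beamCov hN hε hx hβ hp hpfix

/-- Strong duality: the beamforming solution attains the dual value. -/
theorem cost_star (hN : N.StrictlyFeasible) (hε : 0 < ε) (hx : ∀ m, ε ≤ 1 + x m) :
    ∑ m, ((1 + x m) * power (N.beamCov (N.betaStar x) (N.pStar (N.betaStar x) x) x)
      (N.Qmat (N.betaStar x) (N.pStar (N.betaStar x) x) x) m - x m * N.P m)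
      = N.dTilde (N.betaStar x) x := by
  obtain ⟨hβ, hfix⟩ := betaStar_spec hN hε hx
  obtain ⟨hp, hpfix⟩ := pStar_betaStar_spec hN hε hx
  rw [Finset.sum_sub_distrib, cost_beamCov hN hε hx hβ hfix hp, dTilde]
  congr 1
  refine Finset.sum_congr rfl fun k _ => ?_
  rw [sinrLHS_beamCov (norm_dotProduct_beam_pos (posDef_Cmat hε hx hβ) (h_ne_zero hN k)), hpfix]
  simp

theorem dualFun_eq (hN : N.StrictlyFeasible) (hε : 0 < ε) (hx : ∀ m, ε ≤ 1 + x m) :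
    N.dualFun x = N.dTilde (N.betaStar x) x := by
  obtain ⟨hβ, hfix⟩ := betaStar_spec hN hε hx
  refine le_antisymm ?_ (le_csInf ⟨_, _, _, subFeasible_star hN hε hx, rfl⟩ ?_)
  · rw [← cost_star hN hε hx]
    exact dualFun_le hN hε hx (subFeasible_star hN hε hx)
  · rintro _ ⟨V, Q, hVQ, rfl⟩
    rw [Finset.sum_sub_distrib, dTilde]
    exact sub_le_sub_right (weak_duality hN hε hx hβ (fun k => by rw [hfix]) hVQ) _

variable (N) in
/-- The gradient candidate `g(β⋆(x), p⋆(x), x)`. -/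
def gradStar (x : EuclideanSpace ℝ (Fin M)) : EuclideanSpace ℝ (Fin M) :=
  N.gradApprox (N.betaStar x) (N.pStar (N.betaStar x) x) x

/-- `g(β⋆(x), p⋆(x), x)` is a supergradient of the dual function at `x`. -/
theorem dualFun_le_add_inner (hN : N.StrictlyFeasible) (hε : 0 < ε) (hx : ∀ m, ε ≤ 1 + x m)
    {y : EuclideanSpace ℝ (Fin M)} (hy : ∀ m, ε ≤ 1 + y m) :
    N.dualFun y ≤ N.dualFun x + inner ℝ (N.gradStar x) (y - x) := by
  -- The optimal point at x remains feasible at y, and its cost is affine in the multiplier with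
  -- slope PW_m − P_m.
  refine (dualFun_le hN hε hy (subFeasible_star hN hε hx)).trans (le_of_eq ?_)
  rw [dualFun_eq hN hε hx, ← cost_star hN hε hx, PiLp.inner_apply, ← Finset.sum_add_distrib]
  refine Finset.sum_congr rfl fun m _ => ?_
  rw [power_beamCov]
  simp only [gradStar, gradApprox, PiLp.sub_apply, RCLike.inner_apply, conj_trivial]
  ring

/-! ### Continuity in the multipliers -/

variable {β : EuclideanSpace ℝ (Fin K)}

theorem continuousAt_matrix {X : Type*} [TopologicalSpace X] {f : X → Matrix (Fin M) (Fin M) ℂ}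
    {z : X} : ContinuousAt f z ↔ ∀ i j, ContinuousAt (fun z => f z i j) z := by
  refine continuousAt_pi.trans ?_
  simp only [continuousAt_pi]

theorem continuous_baseMat : Continuous fun z : EuclideanSpace ℝ (Fin M) × EuclideanSpace ℝ (Fin K)
    => N.baseMat z.1 z.2 := by
  unfold baseMat
  refine (continuous_const.add (Continuous.matrix_diagonal (by fun_prop))).add ?_
  fun_prop

/-- The entries are rational with the pivot as only variable denominator, so the pivot needs to be
nonzero only at the point itself. -/
theorem continuousAt_elim {X : Type*} [TopologicalSpace X] {f : X → Matrix (Fin M) (Fin M) ℂ}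
    {z : X} (hf : ContinuousAt f z) {m : Fin M} (hH : (f z).IsHermitian) (hm : 0 < (f z m m).re) :
    ContinuousAt (fun z => N.elim m (f z)) z := by
  have h := N.two_rpow_cap_sub_one_pos m
  have hT : N.elimBase m (f z) m m ≠ 0 := by
    rw [elimBase_diag hH]
    exact_mod_cast (by positivity : 0 < (f z m m).re / ((2 : ℝ) ^ N.cap m - 1) * 2 ^ N.cap m).ne'
  have h2 : (((2 : ℝ) ^ N.cap m : ℝ) : ℂ) ≠ 0 := by
    exact_mod_cast (by positivity : (0 : ℝ) < 2 ^ N.cap m).ne'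
  rw [continuousAt_matrix] at hf
  have hB : ∀ i j, ContinuousAt (fun z => N.elimBase m (f z) i j) z := fun i j => by
    simp only [elimBase, Matrix.add_apply, Matrix.single_apply]
    refine (hf i j).add ?_
    split_ifs
    · exact (hf m m).div_const _
    · exact continuousAt_const
  rw [continuousAt_matrix]
  intro i j
  simp only [elim, ← elimBase.eq_1, Matrix.smul_apply, vecMulVec_apply, smul_eq_mul]
  exact ((continuousAt_const.mul (hB m m)).inv₀ (mul_ne_zero h2 hT)).mul ((hB i m).mul (hB m j))

theorem continuousAt_remainder (hε : 0 < ε) (hx : ∀ m, ε ≤ 1 + x m) (hβ : ∀ k, 0 ≤ β k) (n : ℕ) :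
    ContinuousAt (fun z : EuclideanSpace ℝ (Fin M) × EuclideanSpace ℝ (Fin K) =>
      N.remainder z.1 z.2 n) (x, β) := by
  induction n with
  | zero => exact continuous_baseMat.continuousAt
  | succ n ih =>
    by_cases hn : n < M
    · simp only [remainder_succ N _ _ hn, elimRem]
      have h1 := continuousAt_elim (N := N) (m := ⟨n, hn⟩) ih
        (isHermitian_remainder hε hx hβ ⟨n, hn⟩) (remainder_diag_pos hε hx hβ ⟨n, hn⟩)
      rw [continuousAt_matrix] at h1 ih ⊢
      intro i j
      simp only [Matrix.sub_apply, Matrix.add_apply, Matrix.single_apply, Matrix.smul_apply,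
        smul_eq_mul]
      refine ((ih i j).add ?_).sub (continuousAt_const.mul (h1 i j))
      split_ifs
      · exact h1 _ _
      · exact continuousAt_const
    · simpa only [remainder, hn, dif_neg, not_false_eq_true] using ih

theorem continuousAt_Lam (hε : 0 < ε) (hx : ∀ m, ε ≤ 1 + x m) (hβ : ∀ k, 0 ≤ β k) (m : Fin M) :
    ContinuousAt (fun z : EuclideanSpace ℝ (Fin M) × EuclideanSpace ℝ (Fin K) =>
      N.Lam z.1 z.2 m) (x, β) :=
  continuousAt_elim (continuousAt_remainder hε hx hβ m) (isHermitian_remainder hε hx hβ m)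
    (remainder_diag_pos hε hx hβ m)

theorem continuousAt_inv_Cmat (hε : 0 < ε) (hx : ∀ m, ε ≤ 1 + x m) (hβ : ∀ k, 0 ≤ β k) :
    ContinuousAt (fun z : EuclideanSpace ℝ (Fin M) × EuclideanSpace ℝ (Fin K) =>
      (N.Cmat z.1 z.2)⁻¹) (x, β) := by
  have h1 : ContinuousAt (fun z : EuclideanSpace ℝ (Fin M) × EuclideanSpace ℝ (Fin K) =>
      N.Cmat z.1 z.2) (x, β) := by
    unfold Cmat
    refine continuous_baseMat.continuousAt.add ?_
    rw [continuousAt_matrix]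
    intro i j
    simp only [Matrix.diagonal_apply]
    split_ifs
    · exact continuousAt_matrix.1 (continuousAt_Lam hε hx hβ i) i i
    · exact continuousAt_const
  have hdet : (N.Cmat x β).det ≠ 0 :=
    ((Matrix.isUnit_iff_isUnit_det _).1 (posDef_Cmat (N := N) hε hx hβ).isUnit).ne_zero
  refine ContinuousAt.comp (f := fun z : EuclideanSpace ℝ (Fin M) × EuclideanSpace ℝ (Fin K) =>
      N.Cmat z.1 z.2) (g := fun A : Matrix (Fin M) (Fin M) ℂ => A⁻¹) ?_ h1
  refine continuousAt_matrix_inv _ ?_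
  simpa only [Ring.inverse_eq_inv'] using continuousAt_inv₀ hdet

theorem continuousAt_inv_Cmat_mulVec (hε : 0 < ε) (hx : ∀ m, ε ≤ 1 + x m) (hβ : ∀ k, 0 ≤ β k)
    (h : Fin M → ℂ) :
    ContinuousAt (fun z : EuclideanSpace ℝ (Fin M) × EuclideanSpace ℝ (Fin K) =>
      (N.Cmat z.1 z.2)⁻¹ *ᵥ h) (x, β) :=
  ContinuousAt.comp (f := fun z : EuclideanSpace ℝ (Fin M) × EuclideanSpace ℝ (Fin K) =>
      (N.Cmat z.1 z.2)⁻¹) (g := fun A : Matrix (Fin M) (Fin M) ℂ => A *ᵥ h)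
    (continuous_id.matrix_mulVec continuous_const).continuousAt (continuousAt_inv_Cmat hε hx hβ)

theorem continuousAt_Imap (hN : N.StrictlyFeasible) (hε : 0 < ε) (hx : ∀ m, ε ≤ 1 + x m)
    (hβ : ∀ k, 0 ≤ β k) (k : Fin K) :
    ContinuousAt (fun z : EuclideanSpace ℝ (Fin M) × EuclideanSpace ℝ (Fin K) =>
      N.Imap z.1 z.2 k) (x, β) := by
  simp only [Imap_apply, quad]
  refine continuousAt_const.mul (continuousAt_const.div ?_ ?_)
  · exact ContinuousAt.comp (g := fun w : Fin M → ℂ => (star (N.h k) ⬝ᵥ w).re)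
      (Continuous.continuousAt (by fun_prop)) (continuousAt_inv_Cmat_mulVec hε hx hβ _)
  · exact (quad_inv_pos (posDef_Cmat hε hx hβ) (h_ne_zero hN k)).ne'

theorem continuousAt_beam (hN : N.StrictlyFeasible) (hε : 0 < ε) (hx : ∀ m, ε ≤ 1 + x m)
    (hβ : ∀ k, 0 ≤ β k) (k : Fin K) :
    ContinuousAt (fun z : EuclideanSpace ℝ (Fin M) × EuclideanSpace ℝ (Fin K) =>
      N.beam z.2 z.1 k) (x, β) := by
  have h1 := continuousAt_inv_Cmat_mulVec (N := N) hε hx hβ (N.h k)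
  have h2 : ContinuousAt (fun z : EuclideanSpace ℝ (Fin M) × EuclideanSpace ℝ (Fin K) =>
      ‖WithLp.toLp 2 ((N.Cmat z.1 z.2)⁻¹ *ᵥ N.h k)‖) (x, β) :=
    ContinuousAt.comp (f := fun z : EuclideanSpace ℝ (Fin M) × EuclideanSpace ℝ (Fin K) =>
      (N.Cmat z.1 z.2)⁻¹ *ᵥ N.h k) (g := fun w : Fin M → ℂ => ‖WithLp.toLp 2 w‖)
      (Continuous.continuousAt (by fun_prop)) h1
  have h3 := norm_toLp_pos (inv_mulVec_ne_zero (posDef_Cmat (N := N) hε hx hβ) (h_ne_zero hN k))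
  have h4 := Complex.continuous_ofReal.continuousAt.comp (h2.inv₀ h3.ne')
  rw [continuousAt_pi] at h1 ⊢
  intro i
  exact h4.mul (h1 i)

theorem continuousAt_tailVec (hε : 0 < ε) (hx : ∀ m, ε ≤ 1 + x m)
    (hβ : ∀ k, 0 ≤ β k) (m i : Fin M) :
    ContinuousAt (fun z : EuclideanSpace ℝ (Fin M) × EuclideanSpace ℝ (Fin K) =>
      N.tailVec z.2 z.1 m i) (x, β) := by
  simp only [tailVec]
  have h1 := continuousAt_matrix.1 (continuousAt_Lam (N := N) hε hx hβ m)
  split_ifs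
  · refine (h1 i m).div (h1 m m) ?_
    rw [Lam_diag hε hx hβ]
    exact_mod_cast (lamDiag_pos hε hx hβ m).ne'
  · exact continuousAt_const

section

variable {X : Type*} [TopologicalSpace X] {fx : X → EuclideanSpace ℝ (Fin M)}
  {fβ fp : X → EuclideanSpace ℝ (Fin K)} {z : X}

theorem continuousAt_beamPower (hN : N.StrictlyFeasible) (hε : 0 < ε) (hx : ∀ m, ε ≤ 1 + fx z m)
    (hβ : ∀ k, 0 ≤ fβ z k) (hfx : ContinuousAt fx z) (hfβ : ContinuousAt fβ z)
    (hfp : ContinuousAt fp z) (m : Fin M) :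
    ContinuousAt (fun z => N.beamPower (fβ z) (fp z) (fx z) m) z := by
  simp only [beamPower]
  refine tendsto_finsetSum _ fun k _ => ?_
  have h1 : ContinuousAt (fun z => N.beam (fβ z) (fx z) k) z :=
    ContinuousAt.comp (f := fun z => (fx z, fβ z)) (continuousAt_beam hN hε hx hβ k)
      (hfx.prodMk hfβ)
  have h2 : ContinuousAt (fun z => fp z k) z :=
    ContinuousAt.comp (g := fun p : EuclideanSpace ℝ (Fin K) => p k)
      (Continuous.continuousAt (by fun_prop)) hfp
  exact h2.mul (((continuousAt_pi.1 h1 m).norm).pow 2)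

theorem continuousAt_Qmat (hN : N.StrictlyFeasible) (hε : 0 < ε) (hx : ∀ m, ε ≤ 1 + fx z m)
    (hβ : ∀ k, 0 ≤ fβ z k) (hfx : ContinuousAt fx z) (hfβ : ContinuousAt fβ z)
    (hfp : ContinuousAt fp z) :
    ContinuousAt (fun z => N.Qmat (fβ z) (fp z) (fx z)) z := by
  unfold Qmat
  induction List.finRange M with
  | nil => exact continuousAt_const
  | cons m l ih =>
    simp only [List.foldr_cons]
    have ht : ContinuousAt (fun z => N.tailVec (fβ z) (fx z) m) z :=
      continuousAt_pi.2 fun i => ContinuousAt.comp (f := fun z => (fx z, fβ z))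
        (continuousAt_tailVec hε hx hβ m i) (hfx.prodMk hfβ)
    have hs := continuousAt_beamPower (N := N) hN hε hx hβ hfx hfβ hfp m
    have hG : Continuous fun a : (Fin M → ℂ) × ℝ × Matrix (Fin M) (Fin M) ℂ =>
        (1 - vecMulVec a.1 (Pi.single m 1))ᴴ * a.2.2 * (1 - vecMulVec a.1 (Pi.single m 1))
          + Matrix.single m m (((a.2.1 : ℂ) + star a.1 ⬝ᵥ a.2.2 *ᵥ a.1)
            / (((2 : ℝ) ^ N.cap m - 1 : ℝ) : ℂ)) := by
      have hE : Continuous fun a : (Fin M → ℂ) × ℝ × Matrix (Fin M) (Fin M) ℂ =>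
          (1 - vecMulVec a.1 (Pi.single m 1) : Matrix (Fin M) (Fin M) ℂ) :=
        continuous_const.sub (continuous_fst.matrix_vecMulVec continuous_const)
      refine ((hE.matrix_conjTranspose.matrix_mul (by fun_prop)).matrix_mul hE).add ?_
      refine continuous_matrix fun i j => ?_
      simp only [Matrix.single_apply]
      split_ifs
      · refine Continuous.div_const (Continuous.add (by fun_prop) ?_) _
        exact Continuous.dotProduct (by fun_prop)
          (Continuous.matrix_mulVec (by fun_prop) (by fun_prop))
      · exact continuous_const
    exact ContinuousAt.comp (f := fun z => (N.tailVec (fβ z) (fx z) m,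
      N.beamPower (fβ z) (fp z) (fx z) m,
      l.foldr (fun m R => N.backStep (fβ z) (fp z) (fx z) m R) 0)) hG.continuousAt
      (ht.prodMk (hs.prodMk ih))

theorem continuousAt_gradApprox (hN : N.StrictlyFeasible) (hε : 0 < ε)
    (hx : ∀ m, ε ≤ 1 + fx z m) (hβ : ∀ k, 0 ≤ fβ z k) (hfx : ContinuousAt fx z)
    (hfβ : ContinuousAt fβ z) (hfp : ContinuousAt fp z) :
    ContinuousAt (fun z => N.gradApprox (fβ z) (fp z) (fx z)) z := by
  simp only [gradApprox]
  refine ContinuousAt.comp (g := fun w : Fin M → ℝ => WithLp.toLp 2 w)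
    (Continuous.continuousAt (by fun_prop)) (continuousAt_pi.2 fun m => ?_)
  exact ((continuousAt_beamPower hN hε hx hβ hfx hfβ hfp m).add
    (Complex.continuous_re.continuousAt.comp
      (continuousAt_matrix.1 (continuousAt_Qmat hN hε hx hβ hfx hfβ hfp) m m))).sub
    continuousAt_const

theorem continuousAt_Jmap (hN : N.StrictlyFeasible) (hε : 0 < ε)
    (hx : ∀ m, ε ≤ 1 + fx z m) (hβ : ∀ k, 0 ≤ fβ z k) (hfx : ContinuousAt fx z)
    (hfβ : ContinuousAt fβ z) (p : EuclideanSpace ℝ (Fin K)) (k : Fin K) :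
    ContinuousAt (fun z => N.Jmap (fβ z) (fx z) p k) z := by
  have hu : ∀ j, ContinuousAt (fun z => ‖star (N.h k) ⬝ᵥ N.beam (fβ z) (fx z) j‖ ^ 2) z := by
    intro j
    have h1 : ContinuousAt (fun z => N.beam (fβ z) (fx z) j) z :=
      ContinuousAt.comp (f := fun z => (fx z, fβ z)) (continuousAt_beam hN hε hx hβ j)
        (hfx.prodMk hfβ)
    exact ContinuousAt.comp (g := fun w : Fin M → ℂ => ‖star (N.h k) ⬝ᵥ w‖ ^ 2)
      (Continuous.continuousAt (by fun_prop)) h1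
  have hQ : ContinuousAt (fun z => quad (N.Qmat (fβ z) p (fx z)) (N.h k)) z := by
    refine ContinuousAt.comp (g := fun A : Matrix (Fin M) (Fin M) ℂ => quad A (N.h k)) ?_
      (continuousAt_Qmat hN hε hx hβ hfx hfβ continuousAt_const)
    refine Continuous.continuousAt (Complex.continuous_re.comp ?_)
    exact Continuous.dotProduct continuous_const
      (Continuous.matrix_mulVec continuous_id continuous_const)
  simp only [Jmap_apply]
  refine ContinuousAt.div (continuousAt_const.mul (ContinuousAt.add (ContinuousAt.add ?_ hQ)
    continuousAt_const)) (hu k) ?_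
  · exact tendsto_finsetSum _ fun j _ => continuousAt_const.mul (hu j)
  · have := norm_dotProduct_beam_pos (posDef_Cmat (N := N) hε hx hβ) (h_ne_zero hN k)
    positivity

end

end Network

/-- Fixed points of standard mappings depend continuously on parameters. -/
theorem IsInterference.continuousAt_fixedPoint {K : ℕ} {X : Type*} [TopologicalSpace X]
    {F : X → EuclideanSpace ℝ (Fin K) → EuclideanSpace ℝ (Fin K)}
    {q : X → EuclideanSpace ℝ (Fin K)} {z : X} {c B : ℝ} (hc : 0 < c)
    (h : ∀ᶠ y in nhds z, IsInterference (F y) c ∧ (∀ k, 0 ≤ q y k) ∧ F y (q y) = q y ∧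
      ∀ k, q y k ≤ B) (hcont : ∀ k, ContinuousAt (fun y => F y (q z) k) z) :
    ContinuousAt q z := by
  obtain ⟨hF, hq0, hq, hqB⟩ := h.self_of_nhds
  have hqc : ∀ k, c ≤ q z k := fun k => by
    have := hF.le_apply hq0 k
    rwa [hq] at this
  suffices hk : ∀ k, ContinuousAt (fun y => q y k) z from
    ContinuousAt.comp (f := fun y k => q y k) (g := fun w : Fin K → ℝ => WithLp.toLp 2 w)
      (Continuous.continuousAt (by fun_prop)) (continuousAt_pi.2 hk)
  intro k
  have hB : 0 ≤ B := (hq0 k).trans (hqB k)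
  refine Metric.tendsto_nhds.2 fun δ hδ => ?_
  have hD : 0 ≤ 2 * B ^ 3 / c ^ 2 := by positivity
  obtain ⟨r, hr, hrδ⟩ : ∃ r, 0 < r ∧ 2 * B ^ 3 / c ^ 2 * r < δ := by
    refine ⟨δ / (2 * B ^ 3 / c ^ 2 + 1), by positivity, ?_⟩
    rw [mul_div_assoc', div_lt_iff₀ (by positivity)]
    nlinarith
  have he : 1 < Real.exp r := Real.one_lt_exp_iff.2 hr
  -- The old fixed point q(z) is an approximate fixed point of the nearby mapping F_y; the strict
  -- margin comes from q(z) ≥ c > 0 and e^r > 1.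
  have h1 : ∀ᶠ y in nhds z, ∀ l, q z l ≤ Real.exp r * F y (q z) l := by
    refine Filter.eventually_all.2 fun l => ?_
    have hl : q z l < Real.exp r * F z (q z) l := by
      rw [hq]; nlinarith [hqc l]
    exact ((continuousAt_const.mul (hcont l)).eventually_const_lt hl).mono fun y hy => hy.le
  have h2 : ∀ᶠ y in nhds z, ∀ l, F y (q z) l ≤ Real.exp r * q z l := by
    refine Filter.eventually_all.2 fun l => ?_
    have hl : F z (q z) l < Real.exp r * q z l := by
      rw [hq]; nlinarith [hqc l]
    exact ((hcont l).eventually_lt_const hl).mono fun y hy => hy.le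
  filter_upwards [h, h1, h2] with y hy hy1 hy2
  rw [Real.dist_eq, abs_sub_comm]
  exact (hy.1.abs_sub_fixedPoint_le hc hy.2.1 hy.2.2.1 hy.2.2.2 hqc hqB hr.le hy1 hy2 k).trans_lt
    hrδ

namespace Network

open Matrix

variable {M K : ℕ} {N : Network M K} {x : EuclideanSpace ℝ (Fin M)}

/-! ### The gradient of the dual function -/

/-- Points near a boundary point x of the orthant may have negative entries; ε = 1/2 keeps the whole
theory valid there. -/
theorem eventually_bounds (hx : ∀ m, 0 ≤ x m) :
    ∀ᶠ y : EuclideanSpace ℝ (Fin M) in nhds x,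
      (∀ m, 1 / 2 ≤ 1 + y m) ∧ ∀ m, 1 + y m ≤ 2 + ‖x‖ := by
  filter_upwards [Metric.ball_mem_nhds x (by norm_num : (0 : ℝ) < 1 / 2)] with y hy
  have h1 : ∀ m, |y m - x m| ≤ 1 / 2 := fun m =>
    (EuclideanSpace.abs_apply_le_norm (y - x) m).trans (by
      rw [Metric.mem_ball, dist_eq_norm] at hy; exact hy.le)
  refine ⟨fun m => ?_, fun m => ?_⟩
  · linarith [hx m, (abs_le.1 (h1 m)).1]
  · linarith [(abs_le.1 (h1 m)).2, (le_abs_self _).trans (EuclideanSpace.abs_apply_le_norm x m)]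

theorem continuousAt_betaStar (hN : N.StrictlyFeasible) (hx : ∀ m, 0 ≤ x m) :
    ContinuousAt N.betaStar x := by
  have hε : (0 : ℝ) < 1 / 2 := by norm_num
  obtain ⟨c, hc, hI⟩ := Imap_isInterference hN hε
  obtain ⟨B, hB⟩ := exists_bound_of_le_Imap hN hε (2 + ‖x‖)
  have hev := eventually_bounds hx
  refine IsInterference.continuousAt_fixedPoint (F := N.Imap) hc (B := B) ?_ fun k => ?_
  · filter_upwards [hev] with y hy
    obtain ⟨h0, hfix⟩ := betaStar_spec hN hε hy.1
    exact ⟨hI y hy.1, h0, hfix, (hB y _ hy.1 hy.2 h0 fun k => by rw [hfix]).1⟩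
  · have h1 := hev.self_of_nhds.1
    exact ContinuousAt.comp (f := fun y => (y, N.betaStar x))
      (continuousAt_Imap hN hε h1 (betaStar_spec hN hε h1).1 k)
      (continuousAt_id.prodMk continuousAt_const)

theorem continuousAt_pStar (hN : N.StrictlyFeasible) (hx : ∀ m, 0 ≤ x m) :
    ContinuousAt (fun y => N.pStar (N.betaStar y) y) x := by
  have hε : (0 : ℝ) < 1 / 2 := by norm_num
  obtain ⟨c, hc, hJ⟩ := Jmap_isInterference hN hε
  obtain ⟨B, hB⟩ := exists_bound_of_le_Imap hN hε (2 + ‖x‖)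
  have hev := eventually_bounds hx
  refine IsInterference.continuousAt_fixedPoint (F := fun y => N.Jmap (N.betaStar y) y) hc
    (B := B / (1 / 2)) ?_ fun k => ?_
  · filter_upwards [hev] with y hy
    obtain ⟨h0, hfix⟩ := betaStar_spec hN hε hy.1
    obtain ⟨hp, hpfix⟩ := pStar_betaStar_spec hN hε hy.1
    refine ⟨hJ y _ hy.1 h0, hp, hpfix, fun k => ?_⟩
    refine (le_of_le_Jmap hN hε hy.1 h0 hfix hp (fun k => by rw [hpfix]) k).trans ?_
    exact div_le_div_of_nonneg_right (hB y _ hy.1 hy.2 h0 fun k => by rw [hfix]).2 hε.le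
  · have h1 := hev.self_of_nhds.1
    exact continuousAt_Jmap hN hε h1 (betaStar_spec hN hε h1).1 continuousAt_id
      (continuousAt_betaStar hN hx) _ k

theorem continuousAt_gradStar (hN : N.StrictlyFeasible) (hx : ∀ m, 0 ≤ x m) :
    ContinuousAt N.gradStar x := by
  have hε : (0 : ℝ) < 1 / 2 := by norm_num
  have h1 := (eventually_bounds hx).self_of_nhds.1
  exact continuousAt_gradApprox hN hε h1 (betaStar_spec hN hε h1).1 continuousAt_id
    (continuousAt_betaStar hN hx) (continuousAt_pStar hN hx)

/-- The supergradient inequalities at x and at y place the linearization error between ⟨g(y) − g(x),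
y − x⟩ and 0, and g is continuous at x. -/
theorem hasGradientAt_dualFun (hN : N.StrictlyFeasible) (hx : ∀ m, 0 ≤ x m) :
    HasGradientAt N.dualFun (N.gradStar x) x := by
  have hε : (0 : ℝ) < 1 / 2 := by norm_num
  have hev := eventually_bounds hx
  rw [hasGradientAt_iff_isLittleO, Asymptotics.isLittleO_iff]
  intro δ hδ
  have hg := Metric.tendsto_nhds.1 (continuousAt_gradStar hN hx) δ hδ
  filter_upwards [hev, hg] with y hy hgy
  have h1 := dualFun_le_add_inner hN hε hev.self_of_nhds.1 hy.1
  have h2 := dualFun_le_add_inner hN hε hy.1 hev.self_of_nhds.1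
  rw [← neg_sub y x, inner_neg_right] at h2
  have h3 : inner ℝ (N.gradStar y - N.gradStar x) (y - x)
      = inner ℝ (N.gradStar y) (y - x) - inner ℝ (N.gradStar x) (y - x) := inner_sub_left _ _ _
  have h4 := abs_real_inner_le_norm (N.gradStar y - N.gradStar x) (y - x)
  rw [dist_eq_norm] at hgy
  have h5 : ‖N.gradStar y - N.gradStar x‖ * ‖y - x‖ ≤ δ * ‖y - x‖ := by gcongr
  have h6 := (abs_le.1 (h4.trans h5)).1
  rw [Real.norm_eq_abs, abs_le]
  constructor
  · linarith
  · have : 0 ≤ δ * ‖y - x‖ := by positivity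
    linarith

/-! ### Error bounds for the two-stage procedure -/

theorem norm_sub_le_of_abs_sub_le {p q : EuclideanSpace ℝ (Fin K)} {D : ℝ}
    (h : ∀ k, |p k - q k| ≤ D) : ‖p - q‖ ≤ K * D := by
  refine (EuclideanSpace.norm_le_sum_abs _).trans ?_
  refine (Finset.sum_le_sum fun k _ => h k).trans (le_of_eq ?_)
  simp

theorem abs_dTilde_sub_le {β β' : EuclideanSpace ℝ (Fin K)} {D : ℝ}
    (h : ∀ k, |β k - β' k| ≤ D) :
    |N.dTilde β x - N.dTilde β' x| ≤ (∑ k, N.σsq k) * D := by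
  have h1 : N.dTilde β x - N.dTilde β' x = ∑ k, (β k - β' k) * N.σsq k := by
    simp only [dTilde, sub_mul, Finset.sum_sub_distrib]
    ring
  rw [h1, Finset.sum_mul]
  refine (Finset.abs_sum_le_sum_abs _ _).trans (Finset.sum_le_sum fun k _ => ?_)
  rw [abs_mul, abs_of_pos (N.σsq_pos k), mul_comm]
  exact mul_le_mul_of_nonneg_left (h k) (N.σsq_pos k).le

end Network

end

/-! ### The differentiability and error bounds of the proposition -/

theorem proposition4 {M K : ℕ} (N : Network M K) (hN : N.StrictlyFeasible)
    (x : EuclideanSpace ℝ (Fin M)) (hx : ∀ m, 0 ≤ x m) :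
    DifferentiableAt ℝ N.dualFun x ∧
    ∀ B κ₁ L₁ L₂ : ℝ, 0 < κ₁ → 0 ≤ L₁ → 0 ≤ L₂ →
      ∃ C : ℝ, 0 ≤ C ∧
        ∀ (res₁ res₂ : ℝ) (βt pt : EuclideanSpace ℝ (Fin K)), 0 ≤ res₁ → 0 ≤ res₂ →
          N.IsOutput x res₁ res₂ βt pt → ‖βt‖ ≤ B → ‖pt‖ ≤ B →
          N.Regular x βt pt κ₁ L₁ L₂ →
            |N.dTilde βt x - N.dualFun x| ≤ C * (res₁ + res₂) ∧
            ‖N.gradApprox βt pt x - gradient N.dualFun x‖ ≤ C * (res₁ + res₂) := by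
  have hgrad := Network.hasGradientAt_dualFun hN hx
  refine ⟨hgrad.differentiableAt, fun B κ₁ L₁ L₂ _ hL₁ hL₂ => ?_⟩
  have hx1 : ∀ m, 1 ≤ 1 + x m := fun m => by linarith [hx m]
  obtain ⟨hβ0, hβfix⟩ := Network.betaStar_spec hN one_pos hx1
  obtain ⟨cI, hcI, hI⟩ := Network.Imap_isInterference hN one_pos
  obtain ⟨cJ, hcJ, hJ⟩ := Network.Jmap_isInterference hN one_pos
  -- R₁ bounds the entries of β̃ and β⋆(x), and also ‖β̃ − β⋆(x)‖; R₂ bounds those of p̃ and of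
  -- p⋆(β̃,x), which lies within L₁R₁ of p⋆(x). The absolute value keeps both nonnegative for every
  -- B.
  obtain ⟨R₁, hR₁⟩ : ∃ R₁, R₁ = |B| + ‖N.betaStar x‖ := ⟨_, rfl⟩
  obtain ⟨R₂, hR₂⟩ : ∃ R₂, R₂ = |B| + (‖N.pStar (N.betaStar x) x‖ + L₁ * R₁) := ⟨_, rfl⟩
  have hR₁0 : 0 ≤ R₁ := by rw [hR₁]; positivity
  have hR₂0 : 0 ≤ R₂ := by rw [hR₂]; positivity
  obtain ⟨D₁, hD₁⟩ : ∃ D₁, D₁ = 2 * R₁ ^ 3 / cI ^ 2 := ⟨_, rfl⟩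
  obtain ⟨D₂, hD₂⟩ : ∃ D₂, D₂ = 2 * R₂ ^ 3 / cJ ^ 2 := ⟨_, rfl⟩
  have hD₁0 : 0 ≤ D₁ := by rw [hD₁]; positivity
  have hD₂0 : 0 ≤ D₂ := by rw [hD₂]; positivity
  have hσ0 : 0 ≤ ∑ k, N.σsq k := Finset.sum_nonneg fun k _ => (N.σsq_pos k).le
  refine ⟨(∑ k, N.σsq k) * D₁ + L₂ * (K * D₁ + L₁ * (K * D₁) + K * D₂), by positivity, ?_⟩
  intro res₁ res₂ βt pt hres₁ hres₂ hout hβB hpB hreg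
  obtain ⟨β₀, p₀, -, -, hβout, hpout⟩ := hout
  have hBabs := le_abs_self B
  obtain ⟨hβc, hβ1, hβ2⟩ := hβout.approx (hI x hx1) hcI.le hres₁
  have hentry : ∀ (z : EuclideanSpace ℝ (Fin K)) k, z k ≤ ‖z‖ := fun z k =>
    (le_abs_self _).trans (EuclideanSpace.abs_apply_le_norm z k)
  have hβerr : ∀ k, |βt k - N.betaStar x k| ≤ D₁ * res₁ := by
    rw [hD₁]
    refine (hI x hx1).abs_sub_fixedPoint_le hcI hβ0 hβfix (fun k => ?_) hβc (fun k => ?_) hres₁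
      hβ1 hβ2
    · linarith [hentry (N.betaStar x) k, abs_nonneg B]
    · linarith [hentry βt k, norm_nonneg (N.betaStar x)]
  have hβnorm := Network.norm_sub_le_of_abs_sub_le hβerr
  have hβt0 : ∀ k, 0 ≤ βt k := fun k => hcI.le.trans (hβc k)
  -- The second stage iterates J at β̃, so p̃ is first compared with p⋆(β̃,x), whose existence is
  -- part of the assumption, and then with p⋆(x).
  obtain ⟨hp0, hpfix⟩ := Network.pStar_spec_of_exists hreg.exists_fixedPoint
  obtain ⟨hpc, hp1, hp2⟩ := hpout.approx (hJ x βt hx1 hβt0) hcJ.le hres₂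
  have hpstar : ‖N.pStar βt x‖ ≤ ‖N.pStar (N.betaStar x) x‖ + L₁ * R₁ := by
    have h1 : ‖N.pStar βt x‖ ≤ ‖N.pStar (N.betaStar x) x‖
        + ‖N.pStar βt x - N.pStar (N.betaStar x) x‖ := norm_le_insert' _ _
    have h2 : ‖βt - N.betaStar x‖ ≤ R₁ := (norm_sub_le _ _).trans (by linarith)
    have h3 := mul_le_mul_of_nonneg_left h2 hL₁
    linarith [hreg.lipschitz_pStar]
  have hperr : ∀ k, |pt k - N.pStar βt x k| ≤ D₂ * res₂ := by
    rw [hD₂]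
    refine (hJ x βt hx1 hβt0).abs_sub_fixedPoint_le hcJ hp0 hpfix (fun k => ?_) hpc (fun k => ?_)
      hres₂ hp1 hp2
    · linarith [hentry (N.pStar βt x) k, abs_nonneg B]
    · linarith [hentry pt k, norm_nonneg (N.pStar βt x)]
  have hpnorm := Network.norm_sub_le_of_abs_sub_le hperr
  have hpnorm' : ‖pt - N.pStar (N.betaStar x) x‖ ≤ K * (D₂ * res₂) + L₁ * (K * (D₁ * res₁)) := by
    have h1 := norm_sub_le_norm_sub_add_norm_sub pt (N.pStar βt x) (N.pStar (N.betaStar x) x)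
    have h2 := mul_le_mul_of_nonneg_left hβnorm hL₁
    linarith [hreg.lipschitz_pStar]
  have hK : (0 : ℝ) ≤ K := Nat.cast_nonneg K
  -- These nonnegative terms absorb the difference between the separate bounds in res₁, res₂ and one
  -- constant times their sum.
  have e1 : 0 ≤ (∑ k, N.σsq k) * D₁ * res₁ := by positivity
  have e2 : 0 ≤ (∑ k, N.σsq k) * D₁ * res₂ := by positivity
  have e3 : 0 ≤ L₂ * (K * D₁ + L₁ * (K * D₁)) * res₁ := by positivity
  have e4 : 0 ≤ L₂ * (K * D₁ + L₁ * (K * D₁)) * res₂ := by positivity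
  have e5 : 0 ≤ L₂ * (K * D₂) * res₁ := by positivity
  have e6 : 0 ≤ L₂ * (K * D₂) * res₂ := by positivity
  constructor
  · rw [Network.dualFun_eq hN one_pos hx1]
    refine (Network.abs_dTilde_sub_le hβerr).trans ?_
    linarith
  · rw [hgrad.gradient, Network.gradStar]
    refine hreg.lipschitz_grad.trans ?_
    refine (mul_le_mul_of_nonneg_left (add_le_add hβnorm hpnorm') hL₂).trans ?_
    linarith
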